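/- Let $\mathfrak g$ be the Lie algebra of the compact simple Lie group $\mathrm E_7$ (a real Lie algebra with negative definite Killing form whose complexification is the complex simple Lie algebra of type $E_7$), and let $B$ be the negative of its Killing form. Consider on $\mathfrak g$ the generalized Wallach decomposition of type $\mathrm E_7$-II: there are two commuting involutive automorphisms $\sigma,\tau$ of $\mathfrak g$ with $$\mathfrak g^{\sigma}\cong A_7=\mathfrak{su}(8),\qquad \mathfrak g^{\tau}\cong A_1\oplus D_6=\mathfrak{su}(2)\oplus\mathfrak{so}(12),\qquad \mathfrak k:=\mathfrak g^{\sigma}\cap\mathfrak g^{\tau}=\mathrm T\oplus A_1\oplus A_5,$$ where $\mathrm T$ is the center of $\mathfrak k$, $\dim\mathrm T=1$, and $A_1\cong\mathfrak{su}(2)$, $A_5\cong\mathfrak{su}(6)$ are ideals of $\mathfrak k$; and $\mathfrak p_1,\mathfrak p_2,\mathfrak p_3$ are the joint eigenspaces of $(\sigma,\tau)$ for the eigenvalues $(1,-1)$, $(-1,1)$, $(-1,-1)$, respectively, which are irreducible $\mathrm{ad}(\mathfrak k)$-modules. Thus $$\mathfrak g=\mathrm T\oplus A_1\oplus A_5\oplus\mathfrak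 p_1\oplus\mathfrak p_2\oplus\mathfrak p_3,\qquad \mathfrak g^\sigma=\mathfrak k\oplus\mathfrak p_1,\qquad \mathfrak g^\tau=\mathfrak k\oplus\mathfrak p_2.$$ Number these six summands $0,1,2,3,4,5$ in this order, choose a $B$-orthonormal basis $(e^i_\alpha)_\alpha$ of the $i$-th summand for each $i$, and put $$(ijk)=\sum_{\alpha,\beta,\gamma}B\big([e^i_\alpha,e^j_\beta],e^k_\gamma\big)^2 .$$ Then, for every choice of these bases, $$(033)=\tfrac49,\quad (044)=\tfrac59,\quad (055)=0,\quad (345)=\tfrac{20}{3},$$ $$(111)=\tfrac13,\quad (133)=1,\quad (144)=0,\quad (155)=\tfrac53,$$ $$(222)=\tfrac{35}{3},\quad (233)=\tfrac{35}{9},\quad (244)=\tfrac{70}{9},\quad (255)=\tfrac{35}{3},$$ and $(ijk)=0$ for all $i,j,k\in\{0,\dots,5\}$ such that $(i,j,k)$ is not a permutation of one of these twelve index triples. -/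

import Mathlib

open scoped TensorProduct

/-! Matrix algebras carry the commutator bracket `⁅X, Y⁆ = X * Y - Y * X`. -/
attribute [local instance 100] LieRing.ofAssociativeRing

/-- The compact real Lie algebra `𝔰𝔲(n)` (of type `A_{n-1}`): skew-Hermitian complex `n × n`
matrices of trace zero, with the commutator bracket. -/
def su (n : ℕ) : LieSubalgebra ℝ (Matrix (Fin n) (Fin n) ℂ) where
  carrier := {X | X.conjTranspose = -X ∧ X.trace = 0}
  add_mem' := by
    rintro X Y ⟨hX, hX'⟩ ⟨hY, hY'⟩
    refine ⟨?_, ?_⟩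
    · rw [Matrix.conjTranspose_add, hX, hY, neg_add]
    · rw [Matrix.trace_add, hX', hY', add_zero]
  zero_mem' := by simp
  smul_mem' := by
    rintro c X ⟨hX, hX'⟩
    refine ⟨?_, ?_⟩
    · rw [Matrix.conjTranspose_smul, hX, star_trivial, smul_neg]
    · rw [Matrix.trace_smul, hX', smul_zero]
  lie_mem' := by
    rintro X Y ⟨hX, -⟩ ⟨hY, -⟩
    refine ⟨?_, ?_⟩
    · rw [Ring.lie_def, Matrix.conjTranspose_sub, Matrix.conjTranspose_mul,
        Matrix.conjTranspose_mul, hX, hY]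
      noncomm_ring
    · rw [Ring.lie_def, Matrix.trace_sub, Matrix.trace_mul_comm, sub_self]

/-- The compact real Lie algebra `𝔰𝔬(n)` of skew-symmetric real `n × n` matrices. -/
abbrev soReal (n : ℕ) : LieSubalgebra ℝ (Matrix (Fin n) (Fin n) ℝ) :=
  LieAlgebra.Orthogonal.so (Fin n) ℝ

section

variable {𝔤 : Type*} [LieRing 𝔤] [LieAlgebra ℝ 𝔤]

/-- The Lie subalgebra of fixed points of an automorphism of `𝔤`. -/
def fixedSubalgebra (σ : 𝔤 ≃ₗ⁅ℝ⁆ 𝔤) : LieSubalgebra ℝ 𝔤 where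
  carrier := {x | σ x = x}
  add_mem' := by
    intro x y (hx : σ x = x) (hy : σ y = y)
    change σ (x + y) = x + y
    rw [map_add, hx, hy]
  zero_mem' := map_zero σ
  smul_mem' := by
    intro c x (hx : σ x = x)
    change σ (c • x) = c • x
    rw [map_smul, hx]
  lie_mem' := by
    intro x y (hx : σ x = x) (hy : σ y = y)
    change σ ⁅x, y⁆ = ⁅x, y⁆
    rw [LieEquiv.map_lie, hx, hy]

/-- The joint eigenspace `{x | σ x = a x, τ x = b x}` of two automorphisms of `𝔤`. -/
def jointEigenspace (σ τ : 𝔤 ≃ₗ⁅ℝ⁆ 𝔤) (a b : ℝ) : Submodule ℝ 𝔤 where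
  carrier := {x | σ x = a • x ∧ τ x = b • x}
  add_mem' := by
    rintro x y ⟨hx, hx'⟩ ⟨hy, hy'⟩
    refine ⟨?_, ?_⟩
    · rw [map_add, hx, hy, smul_add]
    · rw [map_add, hx', hy', smul_add]
  zero_mem' := by
    refine ⟨?_, ?_⟩
    · rw [map_zero, smul_zero]
    · rw [map_zero, smul_zero]
  smul_mem' := by
    rintro c x ⟨hx, hx'⟩
    refine ⟨?_, ?_⟩
    · rw [map_smul, hx, smul_comm]
    · rw [map_smul, hx', smul_comm]

/-- A subspace `W` of `𝔤` is an irreducible `ad 𝔨`-module: it is nonzero, `ad 𝔨`-invariant, and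
has no `ad 𝔨`-invariant subspaces except `0` and `W`. -/
def IsIrreducibleUnder (𝔨 : LieSubalgebra ℝ 𝔤) (W : Submodule ℝ 𝔤) : Prop :=
  W ≠ ⊥ ∧ (∀ x ∈ 𝔨, ∀ w ∈ W, ⁅x, w⁆ ∈ W) ∧
    ∀ U : Submodule ℝ 𝔤, U ≤ W → (∀ x ∈ 𝔨, ∀ u ∈ U, ⁅x, u⁆ ∈ U) → U = ⊥ ∨ U = W

variable (𝔤) in
/-- `𝔤` is a compact real form of the complex simple Lie algebra of type `E₇`: its Killing form is
negative definite and its complexification is isomorphic to the complex Lie algebra `𝔢₇`. -/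
def IsCompactE7 : Prop :=
  (∀ x : 𝔤, x ≠ 0 → killingForm ℝ 𝔤 x x < 0) ∧
    Nonempty ((ℂ ⊗[ℝ] 𝔤) ≃ₗ⁅ℂ⁆ LieAlgebra.e₇ ℂ)

variable (𝔤) in
/-- The generalized Wallach decomposition of type `E₇`-II of `𝔤`.  It is given by two commuting
involutive automorphisms `σ`, `τ` of `𝔤`, with
* `𝔤^σ ≅ A₇ = 𝔰𝔲(8)` and `𝔤^τ ≅ A₁ ⊕ D₆ = 𝔰𝔲(2) ⊕ 𝔰𝔬(12)`,
* `𝔨 = 𝔤^σ ∩ 𝔤^τ = T ⊕ A₁ ⊕ A₅`, where `T` is the center of `𝔨` and is one-dimensional, and `A₁`,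
  `A₅` are ideals of `𝔨` isomorphic to `𝔰𝔲(2)`, `𝔰𝔲(6)`.
The complement of `𝔨` is the sum of the joint eigenspaces `𝔭₁`, `𝔭₂`, `𝔭₃` of `(σ, τ)` for the
signs `(1, -1)`, `(-1, 1)`, `(-1, -1)`, so that `𝔤^σ = 𝔨 ⊕ 𝔭₁` and `𝔤^τ = 𝔨 ⊕ 𝔭₂`; these are
irreducible `ad 𝔨`-modules. -/
structure E7II where
  σ : 𝔤 ≃ₗ⁅ℝ⁆ 𝔤
  τ : 𝔤 ≃ₗ⁅ℝ⁆ 𝔤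
  σ_invol : ∀ x, σ (σ x) = x
  τ_invol : ∀ x, τ (τ x) = x
  comm : ∀ x, σ (τ x) = τ (σ x)
  fixed_σ : Nonempty (fixedSubalgebra σ ≃ₗ⁅ℝ⁆ su 8)
  fixed_τ : Nonempty (fixedSubalgebra τ ≃ₗ⁅ℝ⁆ (su 2 × soReal 12))
  A₁ : LieIdeal ℝ ↥(fixedSubalgebra σ ⊓ fixedSubalgebra τ)
  A₅ : LieIdeal ℝ ↥(fixedSubalgebra σ ⊓ fixedSubalgebra τ)
  A₁_iso : Nonempty (A₁ ≃ₗ⁅ℝ⁆ su 2)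
  A₅_iso : Nonempty (A₅ ≃ₗ⁅ℝ⁆ su 6)
  finrank_center :
    Module.finrank ℝ (LieAlgebra.center ℝ ↥(fixedSubalgebra σ ⊓ fixedSubalgebra τ)) = 1
  isInternal : DirectSum.IsInternal
    ![(LieAlgebra.center ℝ ↥(fixedSubalgebra σ ⊓ fixedSubalgebra τ)).toSubmodule,
      A₁.toSubmodule, A₅.toSubmodule]
  irred₁ : IsIrreducibleUnder (fixedSubalgebra σ ⊓ fixedSubalgebra τ) (jointEigenspace σ τ 1 (-1))
  irred₂ : IsIrreducibleUnder (fixedSubalgebra σ ⊓ fixedSubalgebra τ) (jointEigenspace σ τ (-1) 1)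
  irred₃ :
    IsIrreducibleUnder (fixedSubalgebra σ ⊓ fixedSubalgebra τ) (jointEigenspace σ τ (-1) (-1))

namespace E7II

/-- The subalgebra `𝔨 = 𝔤^σ ∩ 𝔤^τ`. -/
abbrev 𝔨 (D : E7II 𝔤) : LieSubalgebra ℝ 𝔤 :=
  fixedSubalgebra D.σ ⊓ fixedSubalgebra D.τ

/-- The six summands of `𝔤 = T ⊕ A₁ ⊕ A₅ ⊕ 𝔭₁ ⊕ 𝔭₂ ⊕ 𝔭₃`, indexed in this order by
`0, 1, 2, 3, 4, 5`, as subspaces of `𝔤`. -/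
def summand (D : E7II 𝔤) : Fin 6 → Submodule ℝ 𝔤 :=
  ![(LieAlgebra.center ℝ D.𝔨).toSubmodule.map D.𝔨.toSubmodule.subtype,
    D.A₁.toSubmodule.map D.𝔨.toSubmodule.subtype,
    D.A₅.toSubmodule.map D.𝔨.toSubmodule.subtype,
    jointEigenspace D.σ D.τ 1 (-1),
    jointEigenspace D.σ D.τ (-1) 1,
    jointEigenspace D.σ D.τ (-1) (-1)]

end E7II

variable (𝔤) in
/-- The bilinear form `B`, the negative of the Killing form of `𝔤`. -/
noncomputable def negKilling : LinearMap.BilinForm ℝ 𝔤 := -killingForm ℝ 𝔤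

/-- A basis of a subspace `V` of `𝔤` is orthonormal with respect to `B`. -/
def IsBOrthonormal {ι : Type*} [DecidableEq ι] {V : Submodule ℝ 𝔤} (e : Module.Basis ι ℝ V) :
    Prop :=
  ∀ α β : ι, negKilling 𝔤 (e α : 𝔤) (e β : 𝔤) = if α = β then 1 else 0

/-- The number `(ijk) = ∑_{α,β,γ} B([e_α^i, e_β^j], e_γ^k)²`, for bases `e^i` of subspaces
`V i` of `𝔤`. -/
noncomputable def tripleCoeff {I : Type*} {V : I → Submodule ℝ 𝔤}
    (e : ∀ i, Module.Basis (Fin (Module.finrank ℝ (V i))) ℝ (V i)) (i j k : I) : ℝ :=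
  ∑ α, ∑ β, ∑ γ, (negKilling 𝔤 ⁅(e i α : 𝔤), (e j β : 𝔤)⁆ (e k γ : 𝔤)) ^ 2

end

/-! The coefficients satisfy enough linear relations to be computed without roots or structure
constants. Taking an orthonormal basis of each summand, the definition of the Killing form gives
$\sum_{j,k}(ijk)=\dim V_i$ (`sum_tripleCoeff`). For an automorphism $s$ acting by a sign
$\varepsilon_j$ on $V_j$, the form $-\mathrm{tr}(\mathrm{ad}\,x\,\mathrm{ad}\,y\,s)$ is invariant
under $\mathfrak g^s$. By Schur's lemma (`exists_eq_mul_of_irreducible`) it is a multiple $cB$ on a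
simple ideal of $\mathfrak g^s$, so $\sum_{j,k}\varepsilon_j(ijk)=c\dim V_i$ for each $V_i$ inside
that ideal (`sum_mul_tripleCoeff_of_twistedForm`). This applies to $s=\sigma$ with the ideal
$\mathfrak{su}(8)\supset T,A_1,A_5,\mathfrak p_1$, and to $s=\tau$ with $\mathfrak{so}(12)\supset
T,A_5,\mathfrak p_2$. The summand $A_1$ is the other ideal $\mathfrak{su}(2)$ of $\mathfrak g^\tau$
(`exists_simple_of_fixed_τ`), whence $(144)=0$. Signs and commuting ideals kill every triple not
listed.

These relations leave one parameter, $n=\dim\mathfrak p_3$. Nonnegativity of $(055)$ and $(111)$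
gives $40\le n\le44$. A generator of $T$ squares to scalars $-l,-m,-k$ on the $\mathfrak p_i$, and
the bracket $\mathfrak p_1\times\mathfrak p_2\to\mathfrak p_3$ forces $4lm=(l+m-k)^2$
(`four_mul_eq_sq_of_lie_ne_zero`), which only $n=40$ satisfies (`solve_relations`). -/

/-! ### Simplicity and dimension of $\mathfrak{su}(n)$ -/

open Matrix in
/-- A nonzero subspace of trace-zero matrices which is stable under brackets with trace-zero
matrices contains all trace-zero matrices. -/
theorem Matrix.mem_of_trace_eq_zero_of_stable {ι : Type*} [Fintype ι] [DecidableEq ι]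
    (J : Submodule ℂ (Matrix ι ι ℂ))
    (hJ : ∀ Z : Matrix ι ι ℂ, Z.trace = 0 → ∀ M ∈ J, Z * M - M * Z ∈ J)
    {M : Matrix ι ι ℂ} (hM : M ∈ J) (hM0 : M ≠ 0) (hMt : M.trace = 0)
    {Z : Matrix ι ι ℂ} (hZ : Z.trace = 0) : Z ∈ J := by
  have hE : ∀ i j : ι, i ≠ j → (single i j (1 : ℂ)).trace = 0 := fun i j h =>
    Matrix.trace_single_eq_of_ne i j _ h
  have hsq : ∀ N ∈ J, ∀ i j, i ≠ j → N j i ≠ 0 → single i j (1 : ℂ) ∈ J := by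
    intro N hN i j hij hne
    -- Since $E_{ij}^2=0$, two brackets with $E_{ij}$ turn $N$ into $-2N_{ji}E_{ij}$.
    have h1 := hJ _ (hE i j hij) _ (hJ _ (hE i j hij) _ hN)
    have h2 : single i j (1 : ℂ) * (single i j 1 * N - N * single i j 1)
        - (single i j 1 * N - N * single i j 1) * single i j 1
        = (-2 * N j i) • single i j (1 : ℂ) := by
      have e1 : single i j (1 : ℂ) * single i j 1 = 0 := by simp [hij.symm]
      have e2 : single i j (1 : ℂ) * N * single i j 1 = N j i • single i j (1 : ℂ) := by
        rw [single_mul_mul_single]; simp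
      have : single i j (1 : ℂ) * (single i j 1 * N - N * single i j 1)
        - (single i j 1 * N - N * single i j 1) * single i j 1
        = single i j (1 : ℂ) * single i j 1 * N - (2 : ℂ) • (single i j (1 : ℂ) * N * single i j 1)
          + N * (single i j (1 : ℂ) * single i j 1) := by
        rw [two_smul]; noncomm_ring
      rw [this, e1, e2, smul_smul]; simp
    rw [h2] at h1
    have := J.smul_mem (-2 * N j i)⁻¹ h1
    rwa [smul_smul, inv_mul_cancel₀ (by simpa using hne), one_smul] at this
  have hflip : ∀ i j, i ≠ j → single i j (1 : ℂ) ∈ J → single j i (1 : ℂ) ∈ J := by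
    intro i j hij h
    exact hsq _ h j i hij.symm (by simp)
  -- If $M$ has no off-diagonal entry, it is diagonal but not scalar, being nonzero of trace zero;
  -- then $[E_{ij},M]=(M_{jj}-M_{ii})E_{ij}$ for two distinct diagonal entries.
  have hstart : ∃ i j, i ≠ j ∧ single i j (1 : ℂ) ∈ J := by
    by_cases hoff : ∃ i j, i ≠ j ∧ M j i ≠ 0
    · obtain ⟨i, j, hij, h⟩ := hoff
      exact ⟨i, j, hij, hsq M hM i j hij h⟩
    push Not at hoff
    obtain ⟨i, j, hij⟩ : ∃ i j, M i i ≠ M j j := by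
      by_contra hcon
      push Not at hcon
      apply hM0
      ext i j
      by_cases hij : i = j
      · subst hij
        have : M.trace = Fintype.card ι * M i i := by
          simp only [Matrix.trace, diag_apply]
          rw [Finset.sum_congr rfl fun j _ => hcon j i]
          simp
        rw [hMt] at this
        have hc : (Fintype.card ι : ℂ) ≠ 0 := by
          have : Nonempty ι := ⟨i⟩
          exact_mod_cast Fintype.card_ne_zero
        simpa [hc] using this.symm
      · exact hoff j i (Ne.symm hij)
    have hne : i ≠ j := fun h => hij (by rw [h])
    refine ⟨i, j, hne, ?_⟩
    have h1 := hJ _ (hE i j hne) _ hM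
    have hd : M = diagonal fun k => M k k := by
      ext k l
      by_cases hkl : k = l
      · subst hkl; simp
      · rw [diagonal_apply_ne _ hkl]; exact hoff l k (Ne.symm hkl)
    have h2 : single i j (1 : ℂ) * M - M * single i j 1 = (M j j - M i i) • single i j (1 : ℂ) := by
      ext k l
      rw [hd]
      simp only [sub_apply, mul_diagonal, diagonal_mul, smul_apply, single_apply, diagonal_apply_eq]
      split_ifs with h
      · obtain ⟨rfl, rfl⟩ := h; simp
      · simp
    rw [h2] at h1
    have := J.smul_mem (M j j - M i i)⁻¹ h1
    rwa [smul_smul, inv_mul_cancel₀ (sub_ne_zero.2 hij.symm), one_smul] at this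
  have hrow : ∀ i j l, i ≠ j → i ≠ l → single i j (1 : ℂ) ∈ J → single i l (1 : ℂ) ∈ J := by
    intro i j l hij hil h
    by_cases hjl : j = l
    · rwa [← hjl]
    · have := hJ _ (hE j l hjl) _ h
      rw [single_mul_single_of_ne _ _ _ _ hil.symm, single_mul_single_same, zero_sub, mul_one] at this
      simpa using J.neg_mem this
  have hcol : ∀ i j k, i ≠ j → k ≠ j → single i j (1 : ℂ) ∈ J → single k j (1 : ℂ) ∈ J := by
    intro i j k hij hkj h
    exact hflip _ _ hkj.symm (hrow _ _ _ hij.symm hkj.symm (hflip _ _ hij h))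
  have hall : ∀ k l, k ≠ l → single k l (1 : ℂ) ∈ J := by
    obtain ⟨i, j, hij, h⟩ := hstart
    intro k l hkl
    by_cases hil : i = l
    · subst hil
      exact hcol _ _ _ hij.symm hkl (hflip _ _ hij h)
    · exact hcol _ _ _ hil hkl (hrow _ _ _ hij hil h)
  have hdiag : ∀ k l, single k k (1 : ℂ) - single l l 1 ∈ J := by
    intro k l
    by_cases hkl : k = l
    · subst hkl; simp
    · have := hJ _ (hE k l hkl) _ (hall l k (Ne.symm hkl))
      simpa using this
  obtain ⟨o, -⟩ := hstart
  -- The subtracted multiples of $E_{oo}$ add up to $\mathrm{tr}(Z)E_{oo}=0$.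
  have hdec : Z = ∑ i, ∑ j, if i = j then Z i i • (single i i (1 : ℂ) - single o o 1)
      else Z i j • single i j (1 : ℂ) := by
    have h1 : ∀ i j, (if i = j then Z i i • (single i i (1 : ℂ) - single o o 1)
      else Z i j • single i j (1 : ℂ)) = single i j (Z i j) -
        if i = j then Z i i • single o o (1 : ℂ) else 0 := by
      intro i j
      split_ifs with h
      · subst h; simp [smul_sub]
      · simp
    simp only [h1, Finset.sum_sub_distrib, ← matrix_eq_sum_single]
    simp only [Finset.sum_ite_eq, Finset.mem_univ, if_true, ← Finset.sum_smul]
    have : ∑ i, Z i i = 0 := hZ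
    rw [this]; simp
  rw [hdec]
  refine J.sum_mem fun i _ => J.sum_mem fun j _ => ?_
  split_ifs with h
  · exact J.smul_mem _ (hdiag _ _)
  · exact J.smul_mem _ (hall _ _ h)

theorem mem_su {n : ℕ} {X : Matrix (Fin n) (Fin n) ℂ} :
    X ∈ su n ↔ X.conjTranspose = -X ∧ X.trace = 0 := Iff.rfl

-- The complexification $J=I+iI$ is stable under brackets with trace-zero matrices, hence contains
-- all of them if $I\ne0$; comparing skew-Hermitian parts then descends back to $I$.
open Complex in
theorem su_ideal_eq_bot_or_eq_top (n : ℕ) (I : LieIdeal ℝ (su n)) : I = ⊥ ∨ I = ⊤ := by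
  by_cases hI : I = ⊥
  · exact Or.inl hI
  refine Or.inr ?_
  obtain ⟨m, hm, hm0⟩ : ∃ m ∈ I, m ≠ 0 := by
    by_contra! h
    exact hI ((LieSubmodule.eq_bot_iff _).2 h)
  let J : Submodule ℂ (Matrix (Fin n) (Fin n) ℂ) :=
    { carrier := {M | ∃ a ∈ I, ∃ b ∈ I, M = (a : Matrix (Fin n) (Fin n) ℂ) +
        Complex.I • (b : Matrix (Fin n) (Fin n) ℂ)}
      zero_mem' := ⟨0, I.zero_mem, 0, I.zero_mem, by simp⟩
      add_mem' := by
        rintro _ _ ⟨a, ha, b, hb, rfl⟩ ⟨c, hc, d, hd, rfl⟩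
        refine ⟨a + c, I.add_mem ha hc, b + d, I.add_mem hb hd, ?_⟩
        simp only [AddMemClass.coe_add, smul_add]
        abel
      smul_mem' := by
        rintro z _ ⟨a, ha, b, hb, rfl⟩
        refine ⟨z.re • a - z.im • b, I.sub_mem (I.smul_mem _ ha) (I.smul_mem _ hb),
          z.im • a + z.re • b, I.add_mem (I.smul_mem _ ha) (I.smul_mem _ hb), ?_⟩
        ext i j
        simp only [Matrix.smul_apply, Matrix.add_apply, AddMemClass.coe_add,
          AddSubgroupClass.coe_sub, SetLike.val_smul, smul_eq_mul, Matrix.sub_apply,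
          Complex.real_smul]
        conv_lhs => rw [← Complex.re_add_im z]
        linear_combination (z.im : ℂ) * (b : Matrix (Fin n) (Fin n) ℂ) i j * Complex.I_mul_I }
  have hJ : ∀ Z : Matrix (Fin n) (Fin n) ℂ, Z.trace = 0 → ∀ M ∈ J, Z * M - M * Z ∈ J := by
    rintro Z hZ _ ⟨a, ha, b, hb, rfl⟩
    have hZ' : Z.conjTranspose.trace = 0 := by rw [Matrix.trace_conjTranspose, hZ, star_zero]
    -- The splitting $Z=x+iy$ with $x$, $y$ skew-Hermitian of trace zero.
    let x : su n := ⟨(2 : ℝ)⁻¹ • (Z - Z.conjTranspose), by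
      refine mem_su.2 ⟨?_, ?_⟩
      · rw [Matrix.conjTranspose_smul, star_trivial, Matrix.conjTranspose_sub,
          Matrix.conjTranspose_conjTranspose, ← smul_neg, neg_sub]
      · rw [Matrix.trace_smul, Matrix.trace_sub, hZ, hZ', sub_zero, smul_zero]⟩
    let y : su n := ⟨(-Complex.I) • (2 : ℝ)⁻¹ • (Z + Z.conjTranspose), by
      refine mem_su.2 ⟨?_, ?_⟩
      · rw [Matrix.conjTranspose_smul, Matrix.conjTranspose_smul, star_trivial (2 : ℝ)⁻¹,
          Matrix.conjTranspose_add, Matrix.conjTranspose_conjTranspose, add_comm, ← neg_smul]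
        simp
      · rw [Matrix.trace_smul, Matrix.trace_smul, Matrix.trace_add, hZ, hZ', add_zero, smul_zero,
          smul_zero]⟩
    have hxy : Z = (x : Matrix (Fin n) (Fin n) ℂ) + Complex.I • (y : Matrix (Fin n) (Fin n) ℂ) := by
      simp only [x, y, smul_smul, mul_neg, Complex.I_mul_I, neg_neg, one_smul]
      rw [← smul_add, sub_add_add_cancel, ← two_smul ℝ Z, smul_smul]
      norm_num
    refine ⟨⁅x, a⁆ - ⁅y, b⁆, I.sub_mem (lie_mem_right ℝ _ I _ _ ha) (lie_mem_right ℝ _ I _ _ hb),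
      ⁅x, b⁆ + ⁅y, a⁆, I.add_mem (lie_mem_right ℝ _ I _ _ hb) (lie_mem_right ℝ _ I _ _ ha), ?_⟩
    rw [hxy]
    simp only [AddSubgroupClass.coe_sub, AddMemClass.coe_add, LieSubalgebra.coe_bracket,
      Ring.lie_def, mul_add, add_mul, smul_mul_assoc, mul_smul_comm, smul_add, smul_sub, smul_smul,
      Complex.I_mul_I, neg_smul, one_smul]
    abel
  have hmJ : (m : Matrix (Fin n) (Fin n) ℂ) ∈ J := ⟨m, hm, 0, I.zero_mem, by simp⟩
  rw [eq_top_iff]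
  intro x _
  obtain ⟨a, ha, b, hb, hab⟩ := Matrix.mem_of_trace_eq_zero_of_stable J hJ hmJ
    (by simpa using hm0) m.2.2 x.2.2
  -- $ib=x-a$ is both Hermitian and skew-Hermitian.
  have hb0 : (b : Matrix (Fin n) (Fin n) ℂ) = 0 := by
    have h1 : Complex.I • (b : Matrix (Fin n) (Fin n) ℂ) = ((x - a : su n) : Matrix _ _ ℂ) := by
      rw [AddSubgroupClass.coe_sub, hab, add_sub_cancel_left]
    have h2 := (x - a).2.1
    have h3 := b.2.1
    rw [← h1, Matrix.conjTranspose_smul, h3] at h2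
    simp only [RCLike.star_def, conj_I, smul_neg, neg_smul, neg_neg] at h2
    have h4 : (2 * Complex.I) • (b : Matrix (Fin n) (Fin n) ℂ) = 0 := by
      rw [mul_smul, two_smul]
      nth_rewrite 1 [h2]
      simp
    simpa using h4
  rw [hb0, smul_zero, add_zero] at hab
  rwa [Subtype.ext hab]

theorem su_not_isLieAbelian {n : ℕ} (hn : 2 ≤ n) : ¬ IsLieAbelian (su n) := by
  intro h
  let i : Fin n := ⟨0, by omega⟩
  let j : Fin n := ⟨1, by omega⟩
  have hij : i ≠ j := by simp [i, j]
  let x : su n := ⟨Matrix.single i j 1 - Matrix.single j i 1, by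
    refine mem_su.2 ⟨?_, ?_⟩
    · simp
    · simp [Matrix.trace_single_eq_of_ne _ _ _ hij, Matrix.trace_single_eq_of_ne _ _ _ hij.symm]⟩
  let y : su n := ⟨Matrix.single i j Complex.I + Matrix.single j i Complex.I, by
    refine mem_su.2 ⟨?_, ?_⟩
    · rw [Matrix.conjTranspose_add, Matrix.conjTranspose_single, Matrix.conjTranspose_single,
        RCLike.star_def, Complex.conj_I, neg_add, Matrix.single_neg, Matrix.single_neg, add_comm]
    · simp [Matrix.trace_single_eq_of_ne _ _ _ hij, Matrix.trace_single_eq_of_ne _ _ _ hij.symm]⟩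
  have h1 : ⁅x, y⁆ = 0 := h.trivial x y
  have h2 := congrArg (fun z : su n => (z : Matrix (Fin n) (Fin n) ℂ) i i) h1
  simp [x, y, Ring.lie_def, mul_add, add_mul, sub_mul, mul_sub, hij, hij.symm] at h2

instance su_isSimple (n : ℕ) [h : Fact (2 ≤ n)] : LieAlgebra.IsSimple ℝ (su n) where
  eq_bot_or_eq_top := su_ideal_eq_bot_or_eq_top n
  non_abelian := su_not_isLieAbelian h.out

/-- Multiplication by $i$ exchanges Hermitian and skew-Hermitian matrices, so each space has real
dimension $n^2$. Skew-Hermitian matrices have imaginary trace, so trace zero is a single real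
condition, nontrivial for $n>0$. -/
theorem finrank_su (n : ℕ) (hn : 0 < n) : Module.finrank ℝ (su n) + 1 = n ^ 2 := by
  have : Module.Finite ℝ (selfAdjoint (Matrix (Fin n) (Fin n) ℂ)) :=
    inferInstanceAs (Module.Finite ℝ (selfAdjoint.submodule ℝ (Matrix (Fin n) (Fin n) ℂ)))
  have : Module.Finite ℝ (skewAdjoint (Matrix (Fin n) (Fin n) ℂ)) :=
    inferInstanceAs (Module.Finite ℝ (skewAdjoint.submodule ℝ (Matrix (Fin n) (Fin n) ℂ)))
  have h1 : Module.finrank ℝ (selfAdjoint (Matrix (Fin n) (Fin n) ℂ)) +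
      Module.finrank ℝ (skewAdjoint (Matrix (Fin n) (Fin n) ℂ)) = 2 * n ^ 2 := by
    rw [← Module.finrank_prod, ← (StarModule.decomposeProdAdjoint ℝ (Matrix (Fin n) (Fin n) ℂ)).finrank_eq,
      Module.finrank_matrix]
    simp [Complex.finrank_real_complex]; ring
  have e : selfAdjoint (Matrix (Fin n) (Fin n) ℂ) ≃ₗ[ℝ] skewAdjoint (Matrix (Fin n) (Fin n) ℂ) :=
    { toFun := fun a => ⟨Complex.I • (a : (Matrix (Fin n) (Fin n) ℂ)), by
        rw [skewAdjoint.mem_iff, star_smul, a.2.star_eq]; simp⟩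
      invFun := fun a => ⟨-Complex.I • (a : (Matrix (Fin n) (Fin n) ℂ)), by
        rw [selfAdjoint.mem_iff, star_smul, skewAdjoint.mem_iff.1 a.2, star_neg, RCLike.star_def,
          Complex.conj_I, smul_neg, neg_smul]; simp⟩
      map_add' := fun a b => by ext1; simp
      map_smul' := fun c a => by ext1; exact smul_comm _ _ _
      left_inv := fun a => by ext1; simp [smul_smul]
      right_inv := fun a => by ext1; simp [smul_smul] }
  have h2 : Module.finrank ℝ (skewAdjoint (Matrix (Fin n) (Fin n) ℂ)) = n ^ 2 := by
    have := e.finrank_eq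
    omega
  let f : skewAdjoint (Matrix (Fin n) (Fin n) ℂ) →ₗ[ℝ] ℝ :=
    { toFun := fun a => (Matrix.trace (a : (Matrix (Fin n) (Fin n) ℂ))).im
      map_add' := fun a b => by simp [Matrix.trace_add]
      map_smul' := fun c a => by simp [Matrix.trace_smul] }
  have hf : LinearMap.range f = ⊤ := by
    rw [LinearMap.range_eq_top]
    intro r
    refine ⟨⟨((r : ℂ) / n * Complex.I) • (1 : (Matrix (Fin n) (Fin n) ℂ)), ?_⟩, ?_⟩
    · rw [skewAdjoint.mem_iff, star_smul, star_one, ← neg_smul]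
      simp
    · have : (n : ℂ) ≠ 0 := by exact_mod_cast hn.ne'
      simp only [f, LinearMap.coe_mk, AddHom.coe_mk, Matrix.trace_smul, Matrix.trace_one,
        Fintype.card_fin, smul_eq_mul]
      rw [show (r : ℂ) / n * Complex.I * n = r * Complex.I by field_simp]
      simp
  have h3 := f.finrank_range_add_finrank_ker
  rw [hf, finrank_top, Module.finrank_self, h2] at h3
  have e2 : su n ≃ₗ[ℝ] LinearMap.ker f :=
    { toFun := fun a => ⟨⟨a, a.2.1⟩, by
        change (Matrix.trace (a : (Matrix (Fin n) (Fin n) ℂ))).im = 0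
        rw [a.2.2, Complex.zero_im]⟩
      invFun := fun a => ⟨a.1, a.1.2, by
        have h4 : (Matrix.trace (a.1 : (Matrix (Fin n) (Fin n) ℂ))).im = 0 := a.2
        have h5 : star (a.1 : (Matrix (Fin n) (Fin n) ℂ)) = -a.1 := a.1.2
        have h6 := Matrix.trace_conjTranspose (a.1 : (Matrix (Fin n) (Fin n) ℂ))
        rw [← Matrix.star_eq_conjTranspose, h5, Matrix.trace_neg] at h6
        have h7 := congrArg Complex.re h6
        simp at h7
        exact Complex.ext (by simp; linarith) h4⟩
      map_add' := fun a b => rfl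
      map_smul' := fun c a => rfl
      left_inv := fun a => rfl
      right_inv := fun a => rfl }
  rw [e2.finrank_eq, add_comm, h3]

/-! ### Dimension of $\mathfrak{so}(12)$ and simplicity of $\mathfrak{so}(n)$ for $n\ge5$ -/

theorem finrank_soReal_twelve : Module.finrank ℝ (soReal 12) = 66 := by
  have hs : ∀ (a : soReal 12) (i j : Fin 12), (a : Matrix _ _ ℝ) j i = -(a : Matrix _ _ ℝ) i j := by
    intro a i j
    have := (LieAlgebra.Orthogonal.mem_so (Fin 12) ℝ _).1 a.2
    exact congrFun (congrFun this i) j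
  have e : soReal 12 ≃ₗ[ℝ] ({p : Fin 12 × Fin 12 // p.1 < p.2} → ℝ) :=
    { toFun := fun a p => (a : Matrix _ _ ℝ) p.1.1 p.1.2
      invFun := fun g => ⟨Matrix.of fun i j => if h : i < j then g ⟨(i, j), h⟩ else
          if h : j < i then -g ⟨(j, i), h⟩ else 0, by
        rw [LieAlgebra.Orthogonal.mem_so]
        ext i j
        rcases lt_trichotomy i j with h | h | h
        · simp [h, h.not_gt]
        · subst h; simp
        · simp [h, h.not_gt]⟩
      map_add' := fun a b => rfl
      map_smul' := fun c a => rfl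
      left_inv := fun a => by
        ext i j
        rcases lt_trichotomy i j with h | h | h
        · simp [h]
        · subst h
          have := hs a i i
          simp; linarith
        · simp [h, h.not_gt, hs a i j]
      right_inv := fun g => by
        ext ⟨⟨i, j⟩, h⟩
        have h' : i < j := h
        simp [h'] }
  rw [e.finrank_eq, Module.finrank_fintype_fun_eq_card]
  rfl

namespace Matrix

variable {ι : Type*} [DecidableEq ι]

/-- The infinitesimal rotation in the plane of the coordinates `i` and `j`. -/
def rot (i j : ι) : Matrix ι ι ℝ := single i j 1 - single j i 1

theorem rot_transpose (i j : ι) : (rot i j)ᵀ = -rot i j := by simp [rot]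

variable [Fintype ι]

theorem rot_lie_apply (i j : ι) (M : Matrix ι ι ℝ) (k l : ι) :
    (rot i j * M - M * rot i j) k l =
      (if k = i then M j l else 0) - (if k = j then M i l else 0)
        - (if l = j then M k i else 0) + (if l = i then M k j else 0) := by
  simp only [rot, sub_mul, mul_sub, sub_apply, mul_apply, single_apply, ite_and, ite_mul,
    one_mul, zero_mul, mul_ite, mul_one, mul_zero, Finset.sum_ite_eq',
    Finset.mem_univ, if_true, eq_comm (a := i), eq_comm (a := j), Finset.sum_ite_irrel,
    Finset.sum_const_zero]
  ring

/-- Entries with exactly one index in $\{i,j\}$ transform as vectors of the rotated plane, where the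
generator squares to $-1$; the other entries of a skew matrix are annihilated. Thus
$-(\mathrm{ad}\,\mathrm{rot}_{ij})^2$ is a coordinate projection preserving every ideal. -/
theorem rot_lie_rot_lie_apply {i j : ι} (hij : i ≠ j) {M : Matrix ι ι ℝ}
    (hM : ∀ k l, M l k = -M k l) (k l : ι) :
    (rot i j * (rot i j * M - M * rot i j) - (rot i j * M - M * rot i j) * rot i j) k l =
      if (k = i ∨ k = j) ↔ (l = i ∨ l = j) then 0 else -M k l := by
  have hd : ∀ k, M k k = 0 := fun k => by linarith [hM k k]
  have h5 := hM i j
  have h6 := hM k i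
  have h7 := hM k j
  clear hM
  simp only [rot_lie_apply]
  by_cases h1 : k = i <;> by_cases h2 : k = j <;> by_cases h3 : l = i <;> by_cases h4 : l = j <;>
    first
    | exact absurd (h1.symm.trans h2) hij
    | exact absurd (h3.symm.trans h4) hij
    | (simp [h1, h2, h3, h4, hij, hij.symm, hd]; done)
    | (simp [h1, h2, h3, h4, hij, hij.symm]; linarith)

theorem exists_rot_lie_rot_lie {J : Submodule ℝ (Matrix ι ι ℝ)}
    (hJ : ∀ Z : Matrix ι ι ℝ, Zᵀ = -Z → ∀ M ∈ J, Z * M - M * Z ∈ J)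
    {i j : ι} (hij : i ≠ j) {M : Matrix ι ι ℝ} (hMJ : M ∈ J) (hM : ∀ k l, M l k = -M k l) :
    ∃ N ∈ J, (∀ k l, N l k = -N k l) ∧
      ∀ k l, N k l = if (k = i ∨ k = j) ↔ (l = i ∨ l = j) then 0 else M k l := by
  have h := rot_lie_rot_lie_apply hij hM
  refine ⟨_, J.neg_mem (hJ _ (rot_transpose i j) _ (hJ _ (rot_transpose i j) _ hMJ)), ?_, ?_⟩
  · intro k l
    rw [neg_apply, neg_apply, h, h]
    by_cases hc : (k = i ∨ k = j) ↔ (l = i ∨ l = j)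
    · rw [if_pos hc, if_pos hc.symm, neg_zero, neg_zero]
    · rw [if_neg hc, if_neg (fun h => hc h.symm), hM]
  · intro k l
    rw [neg_apply, h]
    split_ifs <;> simp

/-- Composing the coordinate projections of several planes isolates one entry of $M$; the planes are
built from $a$, $b$ and three auxiliary indices, hence the bound 5. -/
theorem rot_mem_of_apply_ne_zero (hι : 5 ≤ Fintype.card ι) {J : Submodule ℝ (Matrix ι ι ℝ)}
    (hJ : ∀ Z : Matrix ι ι ℝ, Zᵀ = -Z → ∀ M ∈ J, Z * M - M * Z ∈ J)
    {M : Matrix ι ι ℝ} (hMJ : M ∈ J) (hM : ∀ k l, M l k = -M k l) {a b : ι} (hab : M a b ≠ 0) :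
    rot a b ∈ J := by
  have hne : a ≠ b := by
    rintro rfl
    exact hab (by linarith [hM a a])
  have hex : ∀ s : Finset ι, s.card < 5 → ∃ c, c ∉ s := by
    intro s hs
    by_contra! h
    have : s = Finset.univ := Finset.eq_univ_iff_forall.2 h
    rw [this, Finset.card_univ] at hs
    omega
  obtain ⟨j, hj⟩ := hex {a, b} (lt_of_le_of_lt (Finset.card_le_two) (by norm_num))
  obtain ⟨m, hm⟩ := hex {a, b, j} (lt_of_le_of_lt (Finset.card_le_three) (by norm_num))
  obtain ⟨p, hp⟩ := hex {a, b, j, m} (lt_of_le_of_lt (Finset.card_le_four) (by norm_num))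
  simp only [Finset.mem_insert, Finset.mem_singleton, not_or] at hj hm hp
  obtain ⟨hja, hjb⟩ : j ≠ a ∧ j ≠ b := hj
  obtain ⟨hma, hmb, hmj⟩ : m ≠ a ∧ m ≠ b ∧ m ≠ j := hm
  obtain ⟨hpa, hpb, hpj, hpm⟩ : p ≠ a ∧ p ≠ b ∧ p ≠ j ∧ p ≠ m := hp
  obtain ⟨M₁, hM₁J, hM₁, h₁⟩ := exists_rot_lie_rot_lie hJ hja.symm hMJ hM
  obtain ⟨M₂, hM₂J, hM₂, h₂⟩ := exists_rot_lie_rot_lie hJ hmb.symm hM₁J hM₁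
  obtain ⟨M₃, hM₃J, hM₃, h₃⟩ := exists_rot_lie_rot_lie hJ hma.symm hM₂J hM₂
  obtain ⟨M₄, hM₄J, hM₄, h₄⟩ := exists_rot_lie_rot_lie hJ (Ne.symm hpj) hM₃J hM₃
  -- The planes $\{a,j\}$, $\{b,m\}$, $\{a,m\}$ leave only the entries at $\{a,b\}$ and $\{j,m\}$ in
  -- `M₃`; the plane $\{j,p\}$ then keeps only $\{j,m\}$ in `M₄`.
  have key : M₃ - M₄ = M a b • rot a b := by
    ext k l
    rw [sub_apply, h₄, h₃, h₂, h₁]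
    have hba := hM a b
    clear hM h₁ h₂ h₃ h₄ hM₁ hM₂ hM₃ hM₄ hJ hex hab
    simp only [smul_apply, rot, sub_apply, single_apply]
    have hcases : ∀ q, q = a ∨ q = b ∨ q = j ∨ q = m ∨ (q ≠ a ∧ q ≠ b ∧ q ≠ j ∧ q ≠ m) := by
      intro q; tauto
    have hja' := Ne.symm hja
    have hjb' := Ne.symm hjb
    have hma' := Ne.symm hma
    have hmb' := Ne.symm hmb
    have hmj' := Ne.symm hmj
    have hpa' := Ne.symm hpa
    have hpb' := Ne.symm hpb
    have hpj' := Ne.symm hpj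
    have hpm' := Ne.symm hpm
    have hne' := hne.symm
    rcases hcases k with hk | hk | hk | hk | ⟨hka, hkb, hkj, hkm⟩ <;>
      rcases hcases l with hl | hl | hl | hl | ⟨hla, hlb, hlj, hlm⟩ <;>
      simp [*, eq_comm (a := a) (b := k), eq_comm (a := b) (b := k), eq_comm (a := a) (b := l),
        eq_comm (a := b) (b := l)]
  have := J.smul_mem (M a b)⁻¹ (key ▸ J.sub_mem hM₃J hM₄J)
  rwa [smul_smul, inv_mul_cancel₀ hab, one_smul] at this

theorem mem_of_transpose_eq_neg_of_stable (hι : 5 ≤ Fintype.card ι)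
    (J : Submodule ℝ (Matrix ι ι ℝ))
    (hJ : ∀ Z : Matrix ι ι ℝ, Zᵀ = -Z → ∀ M ∈ J, Z * M - M * Z ∈ J)
    {M : Matrix ι ι ℝ} (hMJ : M ∈ J) (hM0 : M ≠ 0) (hMt : Mᵀ = -M)
    {Z : Matrix ι ι ℝ} (hZ : Zᵀ = -Z) : Z ∈ J := by
  have hM : ∀ k l, M l k = -M k l := fun k l => congrFun (congrFun hMt k) l
  obtain ⟨a, b, hab⟩ : ∃ a b, M a b ≠ 0 := by
    by_contra! h
    exact hM0 (by ext i j; exact h i j)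
  have hne : a ≠ b := by
    rintro rfl
    exact hab (by linarith [hM a a])
  have hswap : ∀ i j : ι, rot j i = -rot i j := fun i j => by simp [rot]
  have hrow : ∀ i j k : ι, i ≠ j → k ≠ j → rot i j ∈ J → rot k j ∈ J := by
    intro i j k hij hkj h
    by_cases hik : i = k
    · rwa [← hik]
    · have h1 := hJ _ (rot_transpose k i) _ h
      have : rot k i * rot i j - rot i j * rot k i = rot k j := by
        simp [rot, sub_mul, mul_sub, hij, hij.symm, hkj, hkj.symm, hik, Ne.symm hik]
      rwa [this] at h1
  have hcol : ∀ i j k : ι, i ≠ j → i ≠ k → rot i j ∈ J → rot i k ∈ J := by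
    intro i j k hij hik h
    rw [hswap]
    refine J.neg_mem (hrow j i k hij.symm hik.symm ?_)
    rw [hswap]
    exact J.neg_mem h
  have hall : ∀ k l : ι, rot k l ∈ J := by
    have h0 := rot_mem_of_apply_ne_zero hι hJ hMJ hM hab
    intro k l
    by_cases hkl : k = l
    · subst hkl; simp [rot]
    by_cases hal : a = l
    · subst hal
      refine hrow b a k hne.symm hkl ?_
      rw [hswap]
      exact J.neg_mem h0
    · exact hrow a l k hal hkl (hcol a b l hne hal h0)
  have hdec : (2 : ℝ) • Z = ∑ i, ∑ j, Z i j • rot i j := by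
    have h1 : ∀ i j, Z i j • rot i j = single i j (Z i j) - (single i j (Z i j))ᵀ := by
      intro i j; simp [rot, smul_sub]
    simp only [h1, Finset.sum_sub_distrib, ← Matrix.transpose_sum, ← matrix_eq_sum_single, hZ]
    rw [two_smul, sub_neg_eq_add]
  have : (2 : ℝ) • Z ∈ J := by
    rw [hdec]
    exact J.sum_mem fun i _ => J.sum_mem fun j _ => J.smul_mem _ (hall _ _)
  have := J.smul_mem (2 : ℝ)⁻¹ this
  rwa [smul_smul, inv_mul_cancel₀ (by norm_num), one_smul] at this

end Matrix

theorem soReal_ideal_eq_bot_or_eq_top {n : ℕ} (hn : 5 ≤ n) (I : LieIdeal ℝ (soReal n)) :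
    I = ⊥ ∨ I = ⊤ := by
  by_cases hI : I = ⊥
  · exact Or.inl hI
  refine Or.inr ?_
  obtain ⟨m, hm, hm0⟩ : ∃ m ∈ I, m ≠ 0 := by
    by_contra! h
    exact hI ((LieSubmodule.eq_bot_iff _).2 h)
  have hso : ∀ x : soReal n, (x : Matrix (Fin n) (Fin n) ℝ).transpose = -x := fun x =>
    (LieAlgebra.Orthogonal.mem_so (Fin n) ℝ _).1 x.2
  let J : Submodule ℝ (Matrix (Fin n) (Fin n) ℝ) :=
    I.toSubmodule.map (soReal n).toSubmodule.subtype
  have hJ : ∀ Z : Matrix (Fin n) (Fin n) ℝ, Z.transpose = -Z → ∀ M ∈ J, Z * M - M * Z ∈ J := by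
    rintro Z hZ _ ⟨a, ha, rfl⟩
    exact ⟨⁅(⟨Z, (LieAlgebra.Orthogonal.mem_so (Fin n) ℝ _).2 hZ⟩ : soReal n), a⁆,
      lie_mem_right ℝ _ I _ _ ha, rfl⟩
  rw [eq_top_iff]
  intro x _
  obtain ⟨a, ha, hax⟩ := Matrix.mem_of_transpose_eq_neg_of_stable (by simpa using hn) J hJ
    ⟨m, hm, rfl⟩ (by simpa using hm0) (hso m) (hso x)
  rwa [← Subtype.ext hax]

theorem soReal_not_isLieAbelian {n : ℕ} (hn : 3 ≤ n) : ¬ IsLieAbelian (soReal n) := by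
  intro h
  let i : Fin n := ⟨0, by omega⟩
  let j : Fin n := ⟨1, by omega⟩
  let k : Fin n := ⟨2, by omega⟩
  have hij : i ≠ j := by simp [i, j]
  have hjk : j ≠ k := by simp [j, k]
  have hik : i ≠ k := by simp [i, k]
  let x : soReal n := ⟨Matrix.rot i j,
    (LieAlgebra.Orthogonal.mem_so (Fin n) ℝ _).2 (Matrix.rot_transpose _ _)⟩
  let y : soReal n := ⟨Matrix.rot j k,
    (LieAlgebra.Orthogonal.mem_so (Fin n) ℝ _).2 (Matrix.rot_transpose _ _)⟩
  have h1 : ⁅x, y⁆ = 0 := h.trivial x y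
  have h2 := congrArg (fun z : soReal n => (z : Matrix (Fin n) (Fin n) ℝ) i k) h1
  simp [x, y, Ring.lie_def, Matrix.rot, sub_mul, mul_sub, hij, hij.symm, hjk, hjk.symm, hik,
    hik.symm] at h2

instance soReal_isSimple (n : ℕ) [h : Fact (5 ≤ n)] : LieAlgebra.IsSimple ℝ (soReal n) where
  eq_bot_or_eq_top := soReal_ideal_eq_bot_or_eq_top h.out
  non_abelian := soReal_not_isLieAbelian (by linarith [h.out])

/-! ### Schur's lemma for invariant symmetric forms -/

/-- Two symmetric forms, the first of them positive definite, have a common eigenvector. -/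
theorem exists_eigenvector_of_symm_of_posDef {V : Type*} [AddCommGroup V] [Module ℝ V]
    [FiniteDimensional ℝ V] [Nontrivial V] (B κ : LinearMap.BilinForm ℝ V)
    (hB : ∀ v w, B v w = B w v) (hpos : ∀ v, v ≠ 0 → 0 < B v v) (hκ : ∀ v w, κ v w = κ w v) :
    ∃ c : ℝ, ∃ v, v ≠ 0 ∧ ∀ w, κ v w = c * B v w := by
  let core : InnerProductSpace.Core ℝ V :=
    { inner := fun v w => B v w
      conj_inner_symm := fun v w => by simp [hB v w]
      re_inner_nonneg := fun v => by
        by_cases hv : v = 0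
        · simp [hv]
        · simpa using (hpos v hv).le
      add_left := fun u v w => by simp
      smul_left := fun u v r => by simp
      definite := fun v hv => by
        by_contra h
        exact (hpos v h).ne' hv }
  let _ : NormedAddCommGroup V := core.toNormedAddCommGroup
  let _ : InnerProductSpace ℝ V := InnerProductSpace.ofCore core.toCore
  have hinner : ∀ v w : V, inner ℝ v w = B v w := fun v w => rfl
  have hnd : B.Nondegenerate := by
    refine ⟨fun v hv => ?_, fun v hv => ?_⟩ <;>
    · by_contra h
      exact (hpos v h).ne' (hv v)
  -- `A` represents `κ` with respect to the inner product `B`; it is self-adjoint, so it has a real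
  -- eigenvalue.
  let A : V →ₗ[ℝ] V := (B.toDual hnd).symm.toLinearMap ∘ₗ κ
  have hA : ∀ v w, B (A v) w = κ v w := fun v w =>
    LinearMap.BilinForm.apply_toDual_symm_apply (hB := hnd) (κ v) w
  have hsymm : A.IsSymmetric := fun v w => by
    rw [hinner, hinner, hA, hB v, hA, hκ]
  obtain ⟨c, hc⟩ : ∃ c : ℝ, Module.End.HasEigenvalue A c :=
    ⟨_, hsymm.hasEigenvalue_iSup_of_finiteDimensional⟩
  obtain ⟨v, hv⟩ := hc.exists_hasEigenvector
  refine ⟨c, v, hv.2, fun w => ?_⟩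
  rw [← hA, hv.apply_eq_smul, map_smul, LinearMap.smul_apply, smul_eq_mul]

section

variable {𝔤 : Type*} [LieRing 𝔤] [LieAlgebra ℝ 𝔤]

/-- Schur's lemma for invariant forms: on an irreducible subspace, two symmetric invariant forms,
the first of them positive definite, are proportional. -/
theorem exists_eq_mul_of_irreducible [FiniteDimensional ℝ 𝔤] (K : Set 𝔤) (W : Submodule ℝ 𝔤)
    (hW : W ≠ ⊥) (hKW : ∀ x ∈ K, ∀ w ∈ W, ⁅x, w⁆ ∈ W)
    (hirr : ∀ U ≤ W, (∀ x ∈ K, ∀ u ∈ U, ⁅x, u⁆ ∈ U) → U = ⊥ ∨ U = W)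
    (B κ : LinearMap.BilinForm ℝ 𝔤) (hB : ∀ v w, B v w = B w v)
    (hpos : ∀ v, v ≠ 0 → 0 < B v v) (hκ : ∀ v ∈ W, ∀ w ∈ W, κ v w = κ w v)
    (hBinv : ∀ x ∈ K, ∀ v ∈ W, ∀ w ∈ W, B ⁅x, v⁆ w = -B v ⁅x, w⁆)
    (hκinv : ∀ x ∈ K, ∀ v ∈ W, ∀ w ∈ W, κ ⁅x, v⁆ w = -κ v ⁅x, w⁆) :
    ∃ c : ℝ, ∀ v ∈ W, ∀ w ∈ W, κ v w = c * B v w := by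
  have : Nontrivial W := Submodule.nontrivial_iff_ne_bot.2 hW
  obtain ⟨c, v, hv0, hv⟩ := exists_eigenvector_of_symm_of_posDef
    (B.compl₁₂ W.subtype W.subtype) (κ.compl₁₂ W.subtype W.subtype)
    (fun v w => hB v w) (fun v hv => hpos v (by simpa using hv)) (fun v w => hκ v v.2 w w.2)
  -- The eigenspace of `κ` relative to `B` for the eigenvalue `c`: stable under `K` because both
  -- forms are invariant, and nonzero because it contains `v`.
  let U : Submodule ℝ 𝔤 :=
    { carrier := {u | u ∈ W ∧ ∀ w ∈ W, κ u w = c * B u w}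
      zero_mem' := ⟨W.zero_mem, by simp⟩
      add_mem' := fun {a b} ha hb => ⟨W.add_mem ha.1 hb.1, fun w hw => by
        rw [map_add, map_add, LinearMap.add_apply, LinearMap.add_apply, ha.2 w hw, hb.2 w hw,
          mul_add]⟩
      smul_mem' := fun r a ha => ⟨W.smul_mem r ha.1, fun w hw => by
        rw [map_smul, map_smul, LinearMap.smul_apply, LinearMap.smul_apply, ha.2 w hw,
          smul_eq_mul, smul_eq_mul, mul_left_comm]⟩ }
  have hU : U = W := by
    refine (hirr U (fun u hu => hu.1) fun x hx u hu => ⟨hKW x hx u hu.1, fun w hw => ?_⟩).resolve_left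
      fun hbot => hv0 ?_
    · rw [hκinv x hx u hu.1 w hw, hBinv x hx u hu.1 w hw, hu.2 _ (hKW x hx w hw), mul_neg]
    · have : (v : 𝔤) ∈ U := ⟨v.2, fun w hw => hv ⟨w, hw⟩⟩
      rw [hbot, Submodule.mem_bot] at this
      exact Subtype.ext this
  exact ⟨c, fun v hv w hw => (hU.ge hv).2 w hw⟩

/-! ### Simple subalgebras as subspaces of $\mathfrak g$ -/

/-- A subspace of `𝔤` which is a simple Lie subalgebra. -/
structure IsSimpleSubspace (J : Submodule ℝ 𝔤) : Prop where
  lie_mem : ∀ x ∈ J, ∀ y ∈ J, ⁅x, y⁆ ∈ J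
  eq_bot_or_eq : ∀ U ≤ J, (∀ x ∈ J, ∀ u ∈ U, ⁅x, u⁆ ∈ U) → U = ⊥ ∨ U = J
  non_abelian : ∃ x ∈ J, ∃ y ∈ J, ⁅x, y⁆ ≠ 0

namespace IsSimpleSubspace

theorem of_injective {L : Type*} [LieRing L] [LieAlgebra ℝ L] [LieAlgebra.IsSimple ℝ L]
    (f : L →ₗ⁅ℝ⁆ 𝔤) (hf : Function.Injective f) :
    IsSimpleSubspace (LinearMap.range (f : L →ₗ[ℝ] 𝔤)) where
  lie_mem := by
    rintro _ ⟨x, rfl⟩ _ ⟨y, rfl⟩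
    exact ⟨⁅x, y⁆, f.map_lie x y⟩
  eq_bot_or_eq := by
    intro U hU hst
    let I : LieIdeal ℝ L :=
      { U.comap (f : L →ₗ[ℝ] 𝔤) with
        lie_mem := by
          intro x m hm
          change f ⁅x, m⁆ ∈ U
          rw [f.map_lie]
          exact hst _ ⟨x, rfl⟩ _ hm }
    have hIU : ∀ x, x ∈ I ↔ f x ∈ U := fun x => Iff.rfl
    rcases LieAlgebra.IsSimple.eq_bot_or_eq_top (R := ℝ) I with h | h
    · refine Or.inl ((Submodule.eq_bot_iff _).2 fun u hu => ?_)
      obtain ⟨x, rfl⟩ := hU hu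
      have : x ∈ I := hu
      rw [h, LieSubmodule.mem_bot] at this
      rw [this, map_zero]
    · refine Or.inr (le_antisymm hU ?_)
      rintro _ ⟨x, rfl⟩
      refine (hIU x).1 ?_
      rw [h]
      exact LieSubmodule.mem_top x
  non_abelian := by
    by_contra! h
    refine LieAlgebra.IsSimple.non_abelian ℝ (L := L) ⟨fun x y => hf ?_⟩
    rw [map_zero, f.map_lie]
    exact h _ ⟨x, rfl⟩ _ ⟨y, rfl⟩

variable {J : Submodule ℝ 𝔤} (hJ : IsSimpleSubspace J)

include hJ

theorem ne_bot : J ≠ ⊥ := by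
  rintro rfl
  obtain ⟨x, hx, y, -, h⟩ := hJ.non_abelian
  rw [Submodule.mem_bot] at hx
  simp [hx] at h

/-- A simple algebra is perfect: the span of its brackets is a nonzero ideal. -/
theorem le_of_lie_mem {W : Submodule ℝ 𝔤} (h : ∀ x ∈ J, ∀ y ∈ J, ⁅x, y⁆ ∈ W) : J ≤ W := by
  let U : Submodule ℝ 𝔤 := Submodule.span ℝ {z | ∃ x ∈ J, ∃ y ∈ J, ⁅x, y⁆ = z}
  have hUJ : U ≤ J := by
    refine Submodule.span_le.2 ?_
    rintro _ ⟨x, hx, y, hy, rfl⟩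
    exact hJ.lie_mem x hx y hy
  rcases hJ.eq_bot_or_eq U hUJ fun x hx u hu => Submodule.subset_span ⟨x, hx, u, hUJ hu, rfl⟩
    with h0 | h0
  · obtain ⟨x, hx, y, hy, hne⟩ := hJ.non_abelian
    have : ⁅x, y⁆ ∈ U := Submodule.subset_span ⟨x, hx, y, hy, rfl⟩
    rw [h0, Submodule.mem_bot] at this
    exact absurd this hne
  · rw [← h0]
    refine Submodule.span_le.2 ?_
    rintro _ ⟨x, hx, y, hy, rfl⟩
    exact h x hx y hy

theorem eq_zero_of_central {z : 𝔤} (hz : z ∈ J) (h : ∀ x ∈ J, ⁅x, z⁆ = 0) : z = 0 := by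
  let U : Submodule ℝ 𝔤 :=
    { carrier := {u | u ∈ J ∧ ∀ x ∈ J, ⁅x, u⁆ = 0}
      zero_mem' := ⟨J.zero_mem, by simp⟩
      add_mem' := fun {a b} ha hb => ⟨J.add_mem ha.1 hb.1, fun x hx => by
        rw [lie_add, ha.2 x hx, hb.2 x hx, add_zero]⟩
      smul_mem' := fun r a ha => ⟨J.smul_mem r ha.1, fun x hx => by
        rw [lie_smul, ha.2 x hx, smul_zero]⟩ }
  rcases hJ.eq_bot_or_eq U (fun u hu => hu.1) (fun x hx u hu => by
    rw [hu.2 x hx]; exact U.zero_mem) with h0 | h0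
  · have : z ∈ U := ⟨hz, h⟩
    rwa [h0, Submodule.mem_bot] at this
  · obtain ⟨x, hx, y, hy, hne⟩ := hJ.non_abelian
    exact absurd ((h0.ge hy).2 x hx) hne

/-- A simple subalgebra is contained in every subspace which it normalizes and meets
nontrivially. -/
theorem le_or_inf_eq_bot {W : Submodule ℝ 𝔤} (h : ∀ x ∈ J, ∀ w ∈ W, ⁅x, w⁆ ∈ W) :
    J ≤ W ∨ J ⊓ W = ⊥ := by
  rcases hJ.eq_bot_or_eq (J ⊓ W) inf_le_left
    (fun x hx u hu => ⟨hJ.lie_mem x hx u hu.1, h x hx u hu.2⟩) with h0 | h0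
  · exact Or.inr h0
  · exact Or.inl (inf_eq_left.1 h0)

end IsSimpleSubspace

/-! ### The form $B$ and its twists by automorphisms -/

theorem negKilling_apply (x y : 𝔤) : negKilling 𝔤 x y = -killingForm ℝ 𝔤 x y := rfl

theorem negKilling_comm (x y : 𝔤) : negKilling 𝔤 x y = negKilling 𝔤 y x := by
  rw [negKilling_apply, negKilling_apply, LieModule.traceForm_comm]

theorem negKilling_lie_left (x y z : 𝔤) :
    negKilling 𝔤 ⁅x, y⁆ z = negKilling 𝔤 x ⁅y, z⁆ := by
  rw [negKilling_apply, negKilling_apply, LieModule.traceForm_apply_lie_apply]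

theorem negKilling_lie_left' (x y z : 𝔤) :
    negKilling 𝔤 ⁅x, y⁆ z = -negKilling 𝔤 y ⁅x, z⁆ := by
  rw [negKilling_apply, negKilling_apply, LieModule.traceForm_apply_lie_apply']

theorem negKilling_map (s : 𝔤 ≃ₗ⁅ℝ⁆ 𝔤) (x y : 𝔤) :
    negKilling 𝔤 (s x) (s y) = negKilling 𝔤 x y := by
  rw [negKilling_apply, negKilling_apply, LieAlgebra.killingForm_of_equiv_apply]

open LieAlgebra in
/-- The bilinear form `(x, y) ↦ -tr (ad x ∘ ad y ∘ s)`. -/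
noncomputable def twistedForm (s : 𝔤 ≃ₗ⁅ℝ⁆ 𝔤) : LinearMap.BilinForm ℝ 𝔤 :=
  LinearMap.mk₂ ℝ
    (fun x y => -LinearMap.trace ℝ 𝔤 (ad ℝ 𝔤 x * ad ℝ 𝔤 y * ((s : 𝔤 →ₗ⁅ℝ⁆ 𝔤) : 𝔤 →ₗ[ℝ] 𝔤)))
    (fun x y z => by rw [map_add, add_mul, add_mul, map_add, neg_add])
    (fun c x y => by rw [map_smul, smul_mul_assoc, smul_mul_assoc, map_smul, smul_neg])
    (fun x y z => by rw [map_add, mul_add, add_mul, map_add, neg_add])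
    (fun c x y => by rw [map_smul, mul_smul_comm, smul_mul_assoc, map_smul, smul_neg])

open LieAlgebra in
theorem twistedForm_apply (s : 𝔤 ≃ₗ⁅ℝ⁆ 𝔤) (x y : 𝔤) : twistedForm s x y =
    -LinearMap.trace ℝ 𝔤 (ad ℝ 𝔤 x * ad ℝ 𝔤 y * ((s : 𝔤 →ₗ⁅ℝ⁆ 𝔤) : 𝔤 →ₗ[ℝ] 𝔤)) := rfl

open LieAlgebra in
theorem ad_mul_of_fixed {s : 𝔤 ≃ₗ⁅ℝ⁆ 𝔤} {x : 𝔤} (hx : s x = x) :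
    ad ℝ 𝔤 x * ((s : 𝔤 →ₗ⁅ℝ⁆ 𝔤) : 𝔤 →ₗ[ℝ] 𝔤) = ((s : 𝔤 →ₗ⁅ℝ⁆ 𝔤) : 𝔤 →ₗ[ℝ] 𝔤) * ad ℝ 𝔤 x := by
  ext y
  change ⁅x, s y⁆ = s ⁅x, y⁆
  rw [LieEquiv.map_lie, hx]

/-- Cyclicity of the trace, since $\mathrm{ad}\,x$ commutes with $s$ when $s$ fixes $x$. The same
commutation yields invariance under fixed elements. -/
theorem twistedForm_comm {s : 𝔤 ≃ₗ⁅ℝ⁆ 𝔤} {x : 𝔤} (hx : s x = x) (y : 𝔤) :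
    twistedForm s x y = twistedForm s y x := by
  rw [twistedForm_apply, twistedForm_apply, mul_assoc, LinearMap.trace_mul_comm, mul_assoc,
    mul_assoc, ad_mul_of_fixed hx]

theorem twistedForm_lie_left {s : 𝔤 ≃ₗ⁅ℝ⁆ 𝔤} {z : 𝔤} (hz : s z = z) (x y : 𝔤) :
    twistedForm s ⁅z, x⁆ y = -twistedForm s x ⁅z, y⁆ := by
  rw [twistedForm_apply, twistedForm_apply, LieHom.map_lie, LieHom.map_lie, Ring.lie_def,
    Ring.lie_def, neg_neg]
  generalize hX : LieAlgebra.ad ℝ 𝔤 x = X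
  generalize hY : LieAlgebra.ad ℝ 𝔤 y = Y
  have hZ := ad_mul_of_fixed hz
  generalize LieAlgebra.ad ℝ 𝔤 z = Z at *
  generalize ((s : 𝔤 →ₗ⁅ℝ⁆ 𝔤) : 𝔤 →ₗ[ℝ] 𝔤) = S at *
  have h : LinearMap.trace ℝ 𝔤 (Z * (X * Y * S)) = LinearMap.trace ℝ 𝔤 (X * Y * Z * S) := by
    rw [LinearMap.trace_mul_comm, mul_assoc, mul_assoc, mul_assoc, mul_assoc, hZ]
  have e1 : (Z * X - X * Z) * Y * S = Z * (X * Y * S) - X * Z * Y * S := by noncomm_ring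
  have e2 : X * (Z * Y - Y * Z) * S = X * Z * Y * S - X * Y * Z * S := by noncomm_ring
  rw [e1, e2, map_sub, map_sub, h]
  ring

section

variable {P : Type*} [Fintype P] [DecidableEq P] (b : Module.Basis P ℝ 𝔤)
  (hb : ∀ p q, negKilling 𝔤 (b p) (b q) = if p = q then 1 else 0)

include hb

theorem repr_eq_negKilling (x : 𝔤) (p : P) : b.repr x p = negKilling 𝔤 x (b p) := by
  conv_rhs => rw [← b.sum_repr x]
  rw [map_sum, LinearMap.sum_apply]
  simp [-Module.Basis.sum_repr, hb]

theorem negKilling_eq_sum (x y : 𝔤) :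
    negKilling 𝔤 x y = ∑ q, negKilling 𝔤 x (b q) * negKilling 𝔤 y (b q) := by
  conv_lhs => rw [← b.sum_repr y]
  simp [repr_eq_negKilling b hb, mul_comm]

theorem trace_eq_sum_negKilling (A : 𝔤 →ₗ[ℝ] 𝔤) :
    LinearMap.trace ℝ 𝔤 A = ∑ p, negKilling 𝔤 (A (b p)) (b p) := by
  rw [LinearMap.trace_eq_matrix_trace ℝ b, Matrix.trace]
  simp [LinearMap.toMatrix_apply, repr_eq_negKilling b hb]

/-- Evaluate the trace in an orthonormal eigenbasis of $s$ and move one skew factor $\mathrm{ad}\,x$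
across $B$. This is what turns an identity between forms into a relation between sums of squares. -/
theorem twistedForm_self_eq_sum {s : 𝔤 ≃ₗ⁅ℝ⁆ 𝔤} {ε : P → ℝ} (hs : ∀ p, s (b p) = ε p • b p)
    (x : 𝔤) :
    twistedForm s x x = ∑ p, ε p * ∑ q, negKilling 𝔤 ⁅x, b p⁆ (b q) ^ 2 := by
  rw [twistedForm_apply, trace_eq_sum_negKilling b hb, ← Finset.sum_neg_distrib]
  refine Finset.sum_congr rfl fun p _ => ?_
  change -negKilling 𝔤 ⁅x, ⁅x, s (b p)⁆⁆ (b p) = _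
  rw [hs, lie_smul, lie_smul, map_smul, LinearMap.smul_apply, negKilling_lie_left', smul_neg, neg_neg,
    smul_eq_mul, negKilling_eq_sum b hb]
  simp only [pow_two]

theorem negKilling_self_eq_sum (x : 𝔤) :
    negKilling 𝔤 x x = ∑ p, ∑ q, negKilling 𝔤 ⁅x, b p⁆ (b q) ^ 2 := by
  have h := twistedForm_self_eq_sum b hb (s := LieEquiv.refl) (ε := fun _ => 1) (by simp) x
  simp only [one_mul] at h
  exact h

end

end

section

variable {𝔤 : Type*} [LieRing 𝔤] [LieAlgebra ℝ 𝔤]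

theorem mem_fixedSubalgebra {s : 𝔤 ≃ₗ⁅ℝ⁆ 𝔤} {x : 𝔤} : x ∈ fixedSubalgebra s ↔ s x = x := Iff.rfl

theorem mem_jointEigenspace {s t : 𝔤 ≃ₗ⁅ℝ⁆ 𝔤} {a b : ℝ} {x : 𝔤} :
    x ∈ jointEigenspace s t a b ↔ s x = a • x ∧ t x = b • x := Iff.rfl

theorem IsCompactE7.negKilling_pos (h : IsCompactE7 𝔤) {x : 𝔤} (hx : x ≠ 0) :
    0 < negKilling 𝔤 x x := by
  rw [negKilling_apply, neg_pos]
  exact h.1 x hx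

theorem finrank_sup_of_orthogonal [FiniteDimensional ℝ 𝔤]
    (hpos : ∀ x : 𝔤, x ≠ 0 → 0 < negKilling 𝔤 x x) {U W : Submodule ℝ 𝔤}
    (h : ∀ u ∈ U, ∀ w ∈ W, negKilling 𝔤 u w = 0) :
    Module.finrank ℝ ↥(U ⊔ W) = Module.finrank ℝ U + Module.finrank ℝ W := by
  have hinf : U ⊓ W = ⊥ := by
    refine (Submodule.eq_bot_iff _).2 fun x hx => ?_
    by_contra hne
    exact (hpos x hne).ne' (h x hx.1 x hx.2)
  rw [← Submodule.finrank_sup_add_finrank_inf_eq, hinf, finrank_bot, add_zero]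

namespace IsSimpleSubspace

/-- A simple subalgebra `J` centralizes each subalgebra `W` normalizing it unless `J ≤ W`. -/
theorem le_or_lie_eq_zero {J : Submodule ℝ 𝔤} (hJ : IsSimpleSubspace J) {W : Submodule ℝ 𝔤}
    (hW : ∀ x ∈ J, ∀ w ∈ W, ⁅x, w⁆ ∈ W) (hWJ : ∀ w ∈ W, ∀ x ∈ J, ⁅w, x⁆ ∈ J) :
    J ≤ W ∨ ∀ x ∈ J, ∀ w ∈ W, ⁅x, w⁆ = 0 := by
  refine (hJ.le_or_inf_eq_bot hW).imp_right fun h x hx w hw => ?_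
  have : ⁅x, w⁆ ∈ J ⊓ W := ⟨by rw [← lie_skew]; exact J.neg_mem (hWJ w hw x hx), hW x hx w hw⟩
  rwa [h, Submodule.mem_bot] at this

/-- $J=[J,J]$ and $B([x,y],z)=B(x,[y,z])=0$. -/
theorem negKilling_eq_zero {J : Submodule ℝ 𝔤} (hJ : IsSimpleSubspace J) {z : 𝔤}
    (hz : ∀ x ∈ J, ⁅x, z⁆ = 0) {x : 𝔤} (hx : x ∈ J) : negKilling 𝔤 x z = 0 := by
  have : J ≤ LinearMap.ker ((negKilling 𝔤).flip z) := hJ.le_of_lie_mem fun x _ y hy => by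
    change negKilling 𝔤 ⁅x, y⁆ z = 0
    rw [negKilling_lie_left, hz y hy, map_zero]
  exact this hx

end IsSimpleSubspace

end

/-! ### The six summands: orthogonality, dimensions, position in $\mathfrak g^\sigma$ and $\mathfrak
g^\tau$ -/

namespace E7II

variable {𝔤 : Type*} [LieRing 𝔤] [LieAlgebra ℝ 𝔤] (D : E7II 𝔤)

theorem mem_𝔨 {x : 𝔤} : x ∈ D.𝔨 ↔ D.σ x = x ∧ D.τ x = x := by
  rw [LieSubalgebra.mem_inf, mem_fixedSubalgebra, mem_fixedSubalgebra]

theorem mem_summand_zero {x : 𝔤} : x ∈ D.summand 0 ↔ x ∈ D.𝔨 ∧ ∀ y ∈ D.𝔨, ⁅y, x⁆ = 0 := by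
  constructor
  · rintro ⟨z, hz, rfl⟩
    refine ⟨z.2, fun y hy => ?_⟩
    have := (LieModule.mem_maxTrivSubmodule ℝ D.𝔨 D.𝔨 z).1 hz ⟨y, hy⟩
    exact congrArg Subtype.val this
  · rintro ⟨hx, h⟩
    exact ⟨⟨x, hx⟩, (LieModule.mem_maxTrivSubmodule ℝ D.𝔨 D.𝔨 _).2
      fun y => Subtype.ext (h y y.2), rfl⟩

theorem mem_summand_three {x : 𝔤} : x ∈ D.summand 3 ↔ D.σ x = x ∧ D.τ x = -x := by
  change x ∈ jointEigenspace D.σ D.τ 1 (-1) ↔ _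
  rw [mem_jointEigenspace, one_smul, neg_one_smul]

theorem mem_summand_four {x : 𝔤} : x ∈ D.summand 4 ↔ D.σ x = -x ∧ D.τ x = x := by
  change x ∈ jointEigenspace D.σ D.τ (-1) 1 ↔ _
  rw [mem_jointEigenspace, one_smul, neg_one_smul]

theorem mem_summand_five {x : 𝔤} : x ∈ D.summand 5 ↔ D.σ x = -x ∧ D.τ x = -x := by
  change x ∈ jointEigenspace D.σ D.τ (-1) (-1) ↔ _
  rw [mem_jointEigenspace, neg_one_smul]

theorem map_ideal_le (I : LieIdeal ℝ D.𝔨) :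
    I.toSubmodule.map D.𝔨.toSubmodule.subtype ≤ D.𝔨.toSubmodule := by
  rintro _ ⟨z, -, rfl⟩
  exact z.2

theorem lie_mem_map_ideal (I : LieIdeal ℝ D.𝔨) {x y : 𝔤} (hx : x ∈ D.𝔨)
    (hy : y ∈ I.toSubmodule.map D.𝔨.toSubmodule.subtype) :
    ⁅x, y⁆ ∈ I.toSubmodule.map D.𝔨.toSubmodule.subtype := by
  obtain ⟨z, hz, rfl⟩ := hy
  exact ⟨⁅(⟨x, hx⟩ : D.𝔨), z⁆, lie_mem_right ℝ _ I _ _ hz, rfl⟩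

theorem summand_zero_le : D.summand 0 ≤ D.𝔨.toSubmodule := D.map_ideal_le _

theorem summand_one_le : D.summand 1 ≤ D.𝔨.toSubmodule := D.map_ideal_le D.A₁

theorem summand_two_le : D.summand 2 ≤ D.𝔨.toSubmodule := D.map_ideal_le D.A₅

theorem lie_mem_summand_one {x y : 𝔤} (hx : x ∈ D.𝔨) (hy : y ∈ D.summand 1) :
    ⁅x, y⁆ ∈ D.summand 1 := D.lie_mem_map_ideal D.A₁ hx hy

theorem lie_mem_summand_two {x y : 𝔤} (hx : x ∈ D.𝔨) (hy : y ∈ D.summand 2) :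
    ⁅x, y⁆ ∈ D.summand 2 := D.lie_mem_map_ideal D.A₅ hx hy

theorem 𝔨_eq_sup : D.𝔨.toSubmodule = D.summand 0 ⊔ D.summand 1 ⊔ D.summand 2 := by
  refine le_antisymm (fun x hx => ?_)
    (sup_le (sup_le D.summand_zero_le D.summand_one_le) D.summand_two_le)
  have h := D.isInternal.submodule_iSup_eq_top
  have h2 : (⟨x, hx⟩ : D.𝔨) ∈ (LieAlgebra.center ℝ D.𝔨).toSubmodule ⊔ D.A₁.toSubmodule ⊔
      D.A₅.toSubmodule := by
    refine SetLike.le_def.1 ?_ (Submodule.mem_top (R := ℝ))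
    rw [← h]
    refine iSup_le fun i => ?_
    fin_cases i
    · exact le_sup_left.trans le_sup_left
    · exact le_sup_right.trans le_sup_left
    · exact le_sup_right
  have h3 := Submodule.mem_map_of_mem (f := D.𝔨.toSubmodule.subtype) h2
  rwa [Submodule.map_sup, Submodule.map_sup] at h3

theorem lie_eq_zero_of_mem_one_of_mem_two {x y : 𝔤} (hx : x ∈ D.summand 1)
    (hy : y ∈ D.summand 2) : ⁅x, y⁆ = 0 := by
  have hd : Disjoint D.A₁.toSubmodule D.A₅.toSubmodule :=
    D.isInternal.submodule_iSupIndep.pairwiseDisjoint (show (1 : Fin 3) ≠ 2 by decide)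
  obtain ⟨(a : D.𝔨), ha, rfl⟩ := hx
  obtain ⟨(b : D.𝔨), hb, rfl⟩ := hy
  have h : ⁅a, b⁆ ∈ D.A₁.toSubmodule ⊓ D.A₅.toSubmodule :=
    ⟨lie_mem_left ℝ _ D.A₁ _ _ ha, lie_mem_right ℝ _ D.A₅ _ _ hb⟩
  rw [hd.eq_bot, Submodule.mem_bot] at h
  exact congrArg Subtype.val h

theorem exists_range_eq {n : ℕ} (I : LieIdeal ℝ D.𝔨) (e : I ≃ₗ⁅ℝ⁆ su n) :
    ∃ f : su n →ₗ⁅ℝ⁆ 𝔤, Function.Injective f ∧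
      LinearMap.range (f : su n →ₗ[ℝ] 𝔤) = I.toSubmodule.map D.𝔨.toSubmodule.subtype := by
  refine ⟨(D.𝔨.incl.comp (LieIdeal.incl I)).comp (e.symm : su n →ₗ⁅ℝ⁆ I), ?_, ?_⟩
  · exact (Subtype.val_injective.comp Subtype.val_injective).comp e.symm.injective
  · ext x
    constructor
    · rintro ⟨y, rfl⟩
      exact ⟨e.symm y, (e.symm y).2, rfl⟩
    · rintro ⟨z, hz, rfl⟩
      refine ⟨e ⟨z, hz⟩, ?_⟩
      change ((e.symm (e ⟨z, hz⟩) : D.𝔨) : 𝔤) = z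
      rw [e.symm_apply_apply]

theorem isSimpleSubspace_summand_one : IsSimpleSubspace (D.summand 1) := by
  obtain ⟨e⟩ := D.A₁_iso
  obtain ⟨f, hf, h⟩ := D.exists_range_eq D.A₁ e
  have : Fact (2 ≤ 2) := ⟨le_rfl⟩
  have := IsSimpleSubspace.of_injective f hf
  rwa [h] at this

theorem isSimpleSubspace_summand_two : IsSimpleSubspace (D.summand 2) := by
  obtain ⟨e⟩ := D.A₅_iso
  obtain ⟨f, hf, h⟩ := D.exists_range_eq D.A₅ e
  have : Fact (2 ≤ 6) := ⟨by norm_num⟩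
  have := IsSimpleSubspace.of_injective f hf
  rwa [h] at this

theorem finrank_summand_zero : Module.finrank ℝ (D.summand 0) = 1 :=
  (Submodule.finrank_map_subtype_eq _ _).trans D.finrank_center

theorem finrank_summand_one : Module.finrank ℝ (D.summand 1) = 3 := by
  obtain ⟨e⟩ := D.A₁_iso
  have h : Module.finrank ℝ (D.summand 1) = Module.finrank ℝ D.A₁ :=
    Submodule.finrank_map_subtype_eq _ _
  rw [h, e.toLinearEquiv.finrank_eq]
  have := finrank_su 2 (by norm_num)
  omega

theorem finrank_summand_two : Module.finrank ℝ (D.summand 2) = 35 := by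
  obtain ⟨e⟩ := D.A₅_iso
  have h : Module.finrank ℝ (D.summand 2) = Module.finrank ℝ D.A₅ :=
    Submodule.finrank_map_subtype_eq _ _
  rw [h, e.toLinearEquiv.finrank_eq]
  have := finrank_su 6 (by norm_num)
  omega

theorem finrank_fixed_σ : Module.finrank ℝ (fixedSubalgebra D.σ).toSubmodule = 63 := by
  obtain ⟨e⟩ := D.fixed_σ
  have := finrank_su 8 (by norm_num)
  have h : Module.finrank ℝ (fixedSubalgebra D.σ).toSubmodule = Module.finrank ℝ (su 8) :=
    e.toLinearEquiv.finrank_eq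
  omega

theorem isSimpleSubspace_fixed_σ : IsSimpleSubspace (fixedSubalgebra D.σ).toSubmodule := by
  obtain ⟨e⟩ := D.fixed_σ
  have : Fact (2 ≤ 8) := ⟨by norm_num⟩
  have h := IsSimpleSubspace.of_injective ((fixedSubalgebra D.σ).incl.comp
    (e.symm : su 8 →ₗ⁅ℝ⁆ fixedSubalgebra D.σ)) (Subtype.val_injective.comp e.symm.injective)
  convert h
  ext x
  constructor
  · intro hx
    refine ⟨e ⟨x, hx⟩, ?_⟩
    change ((e.symm (e ⟨x, hx⟩) : fixedSubalgebra D.σ) : 𝔤) = x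
    rw [e.symm_apply_apply]
  · rintro ⟨y, rfl⟩
    exact (e.symm y).2

theorem exists_fixed_τ : ∃ (f₁ : su 2 →ₗ⁅ℝ⁆ 𝔤) (f₂ : soReal 12 →ₗ⁅ℝ⁆ 𝔤),
    Function.Injective f₁ ∧ Function.Injective f₂ ∧ (∀ x y, ⁅f₁ x, f₂ y⁆ = 0) ∧
    (∀ x, f₁ x ∈ fixedSubalgebra D.τ) ∧ (∀ x, f₂ x ∈ fixedSubalgebra D.τ) ∧
    ∀ x ∈ fixedSubalgebra D.τ, ∃ y z, x = f₁ y + f₂ z := by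
  obtain ⟨e⟩ := D.fixed_τ
  let g : su 2 × soReal 12 →ₗ⁅ℝ⁆ 𝔤 := (fixedSubalgebra D.τ).incl.comp
    (e.symm : su 2 × soReal 12 →ₗ⁅ℝ⁆ fixedSubalgebra D.τ)
  have hg : Function.Injective g := Subtype.val_injective.comp e.symm.injective
  refine ⟨g.comp (LieHom.inl ℝ (su 2) (soReal 12)), g.comp (LieHom.inr ℝ (su 2) (soReal 12)),
    hg.comp LieHom.inl_injective, hg.comp LieHom.inr_injective, fun x y => ?_,
    fun x => (e.symm (x, 0)).2, fun x => (e.symm (0, x)).2, fun x hx => ?_⟩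
  · change ⁅g (x, 0), g (0, y)⁆ = 0
    have h : ⁅((x, 0) : su 2 × soReal 12), ((0, y) : su 2 × soReal 12)⁆ = 0 :=
      Prod.ext (lie_zero x) (zero_lie y)
    rw [← LieHom.map_lie, h, map_zero]
  · refine ⟨(e ⟨x, hx⟩).1, (e ⟨x, hx⟩).2, ?_⟩
    change x = g ((e ⟨x, hx⟩).1, 0) + g (0, (e ⟨x, hx⟩).2)
    rw [← map_add]
    change x = ((e.symm ((e ⟨x, hx⟩).1 + 0, 0 + (e ⟨x, hx⟩).2) : fixedSubalgebra D.τ) : 𝔤)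
    rw [add_zero, zero_add, Prod.mk.eta, e.symm_apply_apply]

section

theorem negKilling_eq_zero_of_eigen (s : 𝔤 ≃ₗ⁅ℝ⁆ 𝔤) {x y : 𝔤} (hx : s x = x) (hy : s y = -y) :
    negKilling 𝔤 x y = 0 := by
  have := negKilling_map s x y
  rw [hx, hy, map_neg] at this
  linarith

/-- Summands with different signs are separated by an invariant automorphism; of two summands of
$\mathfrak k$, one is simple and centralized by the other. -/
theorem negKilling_summand_eq_zero {i j : Fin 6} (hij : i < j) {x y : 𝔤} (hx : x ∈ D.summand i)
    (hy : y ∈ D.summand j) : negKilling 𝔤 x y = 0 := by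
  have hk : ∀ i : Fin 6, i = 0 ∨ i = 1 ∨ i = 2 → ∀ z ∈ D.summand i, D.σ z = z ∧ D.τ z = z := by
    rintro i (rfl | rfl | rfl) z hz
    · exact D.mem_𝔨.1 (D.summand_zero_le hz)
    · exact D.mem_𝔨.1 (D.summand_one_le hz)
    · exact D.mem_𝔨.1 (D.summand_two_le hz)
  have h34 : ∀ z ∈ D.summand 3, ∀ w ∈ D.summand 4, negKilling 𝔤 z w = 0 := fun z hz w hw =>
    negKilling_eq_zero_of_eigen D.σ (D.mem_summand_three.1 hz).1 (D.mem_summand_four.1 hw).1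
  have h35 : ∀ z ∈ D.summand 3, ∀ w ∈ D.summand 5, negKilling 𝔤 z w = 0 := fun z hz w hw =>
    negKilling_eq_zero_of_eigen D.σ (D.mem_summand_three.1 hz).1 (D.mem_summand_five.1 hw).1
  have h45 : ∀ z ∈ D.summand 4, ∀ w ∈ D.summand 5, negKilling 𝔤 z w = 0 := fun z hz w hw =>
    negKilling_eq_zero_of_eigen D.τ (D.mem_summand_four.1 hz).2 (D.mem_summand_five.1 hw).2
  have h3 : ∀ z w, D.σ z = z ∧ D.τ z = z → w ∈ D.summand 3 → negKilling 𝔤 z w = 0 :=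
    fun z w hz hw => negKilling_eq_zero_of_eigen D.τ hz.2 (D.mem_summand_three.1 hw).2
  have h4 : ∀ z w, D.σ z = z ∧ D.τ z = z → w ∈ D.summand 4 → negKilling 𝔤 z w = 0 :=
    fun z w hz hw => negKilling_eq_zero_of_eigen D.σ hz.1 (D.mem_summand_four.1 hw).1
  have h5 : ∀ z w, D.σ z = z ∧ D.τ z = z → w ∈ D.summand 5 → negKilling 𝔤 z w = 0 :=
    fun z w hz hw => negKilling_eq_zero_of_eigen D.σ hz.1 (D.mem_summand_five.1 hw).1
  have h01 : ∀ z ∈ D.summand 0, ∀ w ∈ D.summand 1, negKilling 𝔤 z w = 0 := fun z hz w hw => by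
    rw [negKilling_comm]
    exact D.isSimpleSubspace_summand_one.negKilling_eq_zero
      (fun u hu => (D.mem_summand_zero.1 hz).2 u (D.summand_one_le hu)) hw
  have h02 : ∀ z ∈ D.summand 0, ∀ w ∈ D.summand 2, negKilling 𝔤 z w = 0 := fun z hz w hw => by
    rw [negKilling_comm]
    exact D.isSimpleSubspace_summand_two.negKilling_eq_zero
      (fun u hu => (D.mem_summand_zero.1 hz).2 u (D.summand_two_le hu)) hw
  have h12 : ∀ z ∈ D.summand 1, ∀ w ∈ D.summand 2, negKilling 𝔤 z w = 0 := fun z hz w hw =>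
    D.isSimpleSubspace_summand_one.negKilling_eq_zero
      (fun u hu => D.lie_eq_zero_of_mem_one_of_mem_two hu hw) hz
  fin_cases i <;> fin_cases j <;> first
    | exact absurd hij (by decide)
    | exact h01 x hx y hy
    | exact h02 x hx y hy
    | exact h12 x hx y hy
    | exact h34 x hx y hy
    | exact h35 x hx y hy
    | exact h45 x hx y hy
    | exact h3 x y (hk _ (by decide) x hx) hy
    | exact h4 x y (hk _ (by decide) x hx) hy
    | exact h5 x y (hk _ (by decide) x hx) hy

theorem negKilling_summand_eq_zero' {i j : Fin 6} (hij : i ≠ j) {x y : 𝔤} (hx : x ∈ D.summand i)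
    (hy : y ∈ D.summand j) : negKilling 𝔤 x y = 0 := by
  rcases lt_or_gt_of_ne hij with h | h
  · exact D.negKilling_summand_eq_zero h hx hy
  · rw [negKilling_comm]
    exact D.negKilling_summand_eq_zero h hy hx

theorem fixed_σ_eq_sup : (fixedSubalgebra D.σ).toSubmodule = D.𝔨.toSubmodule ⊔ D.summand 3 := by
  refine le_antisymm (fun x hx => ?_) (sup_le (fun x hx => (D.mem_𝔨.1 hx).1) fun x hx =>
    (D.mem_summand_three.1 hx).1)
  have hx : D.σ x = x := hx
  refine Submodule.mem_sup.2 ⟨(2 : ℝ)⁻¹ • (x + D.τ x), ?_, (2 : ℝ)⁻¹ • (x - D.τ x), ?_, ?_⟩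
  · refine D.mem_𝔨.2 ⟨?_, ?_⟩
    · rw [map_smul, map_add, D.comm, hx]
    · rw [map_smul, map_add, D.τ_invol, add_comm]
  · refine D.mem_summand_three.2 ⟨?_, ?_⟩
    · rw [map_smul, map_sub, D.comm, hx]
    · rw [map_smul, map_sub, D.τ_invol, ← smul_neg, neg_sub]
  · rw [← smul_add, add_add_sub_cancel, ← two_smul ℝ x, smul_smul]
    norm_num

theorem fixed_τ_eq_sup : (fixedSubalgebra D.τ).toSubmodule = D.𝔨.toSubmodule ⊔ D.summand 4 := by
  refine le_antisymm (fun x hx => ?_) (sup_le (fun x hx => (D.mem_𝔨.1 hx).2) fun x hx =>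
    (D.mem_summand_four.1 hx).2)
  have hx : D.τ x = x := hx
  refine Submodule.mem_sup.2 ⟨(2 : ℝ)⁻¹ • (x + D.σ x), ?_, (2 : ℝ)⁻¹ • (x - D.σ x), ?_, ?_⟩
  · refine D.mem_𝔨.2 ⟨?_, ?_⟩
    · rw [map_smul, map_add, D.σ_invol, add_comm]
    · rw [map_smul, map_add, ← D.comm, hx]
  · refine D.mem_summand_four.2 ⟨?_, ?_⟩
    · rw [map_smul, map_sub, D.σ_invol, ← smul_neg, neg_sub]
    · rw [map_smul, map_sub, ← D.comm, hx]
  · rw [← smul_add, add_add_sub_cancel, ← two_smul ℝ x, smul_smul]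
    norm_num

theorem iSup_summand : ⨆ i, D.summand i = ⊤ := by
  rw [eq_top_iff]
  intro x _
  have hk : D.𝔨.toSubmodule ≤ ⨆ i, D.summand i := by
    rw [𝔨_eq_sup]
    exact sup_le (sup_le (le_iSup _ _) (le_iSup _ _)) (le_iSup _ _)
  have h1 : (fixedSubalgebra D.σ).toSubmodule ≤ ⨆ i, D.summand i := by
    rw [fixed_σ_eq_sup]
    exact sup_le hk (le_iSup _ _)
  have h2 : (2 : ℝ)⁻¹ • (x + D.σ x) ∈ ⨆ i, D.summand i := by
    refine h1 (?_ : D.σ _ = _)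
    rw [map_smul, map_add, D.σ_invol, add_comm]
  -- `y` is twice the component of `x` on which σ acts by $-1$, so its two τ-components below carry
  -- the factor $1/4$.
  let y := x - D.σ x
  have hy : D.σ y = -y := by simp only [y]; rw [map_sub, D.σ_invol, neg_sub]
  have h3 : (4 : ℝ)⁻¹ • (y + D.τ y) ∈ ⨆ i, D.summand i := by
    refine (le_iSup D.summand 4) (D.mem_summand_four.2 ⟨?_, ?_⟩)
    · rw [map_smul, map_add, D.comm, hy, map_neg, ← neg_add, smul_neg]
    · rw [map_smul, map_add, D.τ_invol, add_comm]
  have h4 : (4 : ℝ)⁻¹ • (y - D.τ y) ∈ ⨆ i, D.summand i := by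
    refine (le_iSup D.summand 5) (D.mem_summand_five.2 ⟨?_, ?_⟩)
    · rw [map_smul, map_sub, D.comm, hy, map_neg, ← neg_sub', smul_neg]
    · rw [map_smul, map_sub, D.τ_invol, ← smul_neg, neg_sub]
  have : x = (2 : ℝ)⁻¹ • (x + D.σ x) + ((4 : ℝ)⁻¹ • (y + D.τ y) + (4 : ℝ)⁻¹ • (y - D.τ y)) := by
    simp only [y]
    module
  rw [this]
  exact Submodule.add_mem _ h2 (Submodule.add_mem _ h3 h4)

section

variable [FiniteDimensional ℝ 𝔤] (hpos : ∀ x : 𝔤, x ≠ 0 → 0 < negKilling 𝔤 x x)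

include hpos

theorem finrank_𝔨 : Module.finrank ℝ D.𝔨.toSubmodule = 39 := by
  rw [𝔨_eq_sup, finrank_sup_of_orthogonal hpos, finrank_sup_of_orthogonal hpos,
    finrank_summand_zero, finrank_summand_one, finrank_summand_two]
  · exact fun x hx y hy => D.negKilling_summand_eq_zero (by decide) hx hy
  · intro x hx y hy
    obtain ⟨u, hu, v, hv, rfl⟩ := Submodule.mem_sup.1 hx
    rw [map_add, LinearMap.add_apply, D.negKilling_summand_eq_zero (by decide) hu hy,
      D.negKilling_summand_eq_zero (by decide) hv hy, add_zero]

/-- $63-39$; likewise $\dim\mathfrak p_2=69-39$. The dimension of $\mathfrak p_3$ stays unknown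
until the relations are solved. -/
theorem finrank_summand_three : Module.finrank ℝ (D.summand 3) = 24 := by
  have h := D.finrank_fixed_σ
  rw [fixed_σ_eq_sup, finrank_sup_of_orthogonal hpos, D.finrank_𝔨 hpos] at h
  · omega
  · exact fun x hx y hy =>
      negKilling_eq_zero_of_eigen D.τ (D.mem_𝔨.1 hx).2 (D.mem_summand_three.1 hy).2

theorem finrank_summand_four : Module.finrank ℝ (D.summand 4) = 30 := by
  obtain ⟨e⟩ := D.fixed_τ
  have h : Module.finrank ℝ (fixedSubalgebra D.τ).toSubmodule = 69 := by
    have h1 : Module.finrank ℝ (fixedSubalgebra D.τ).toSubmodule =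
        Module.finrank ℝ (su 2 × soReal 12) := e.toLinearEquiv.finrank_eq
    have : Module.Finite ℝ (su 2) := Module.finite_of_finrank_pos (by
      have := finrank_su 2 (by norm_num); omega)
    have : Module.Finite ℝ (soReal 12) := Module.finite_of_finrank_pos (by
      rw [finrank_soReal_twelve]; norm_num)
    rw [h1, Module.finrank_prod, finrank_soReal_twelve]
    have := finrank_su 2 (by norm_num)
    omega
  rw [fixed_τ_eq_sup, finrank_sup_of_orthogonal hpos, D.finrank_𝔨 hpos] at h
  · omega
  · exact fun x hx y hy =>
      negKilling_eq_zero_of_eigen D.σ (D.mem_𝔨.1 hx).1 (D.mem_summand_four.1 hy).1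

/-- The summand `A₁` of `𝔨` is the ideal `𝔰𝔲(2)` of `𝔤^τ`, and the other summands of `𝔤^τ` lie in
the ideal `𝔰𝔬(12)`. -/
theorem exists_simple_of_fixed_τ : ∃ J : Submodule ℝ 𝔤, IsSimpleSubspace J ∧
    J ≤ (fixedSubalgebra D.τ).toSubmodule ∧ D.summand 0 ≤ J ∧ D.summand 2 ≤ J ∧
    D.summand 4 ≤ J ∧ ∀ x ∈ D.summand 1, ∀ y ∈ J, ⁅x, y⁆ = 0 := by
  obtain ⟨f₁, f₂, hf₁, hf₂, hcomm, hτ₁, hτ₂, hdec⟩ := D.exists_fixed_τ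
  have : Fact (2 ≤ 2) := ⟨le_rfl⟩
  have : Fact (5 ≤ 12) := ⟨by norm_num⟩
  let J₁ := LinearMap.range (f₁ : su 2 →ₗ[ℝ] 𝔤)
  let J₂ := LinearMap.range (f₂ : soReal 12 →ₗ[ℝ] 𝔤)
  have hJ₁ : IsSimpleSubspace J₁ := .of_injective f₁ hf₁
  have hJ₂ : IsSimpleSubspace J₂ := .of_injective f₂ hf₂
  have hd₁ : Module.finrank ℝ J₁ = 3 := by
    have h : Module.finrank ℝ J₁ = Module.finrank ℝ (su 2) := LinearMap.finrank_range_of_inj hf₁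
    have := finrank_su 2 (by norm_num)
    omega
  have hd₂ : Module.finrank ℝ J₂ = 66 :=
    (LinearMap.finrank_range_of_inj hf₂).trans finrank_soReal_twelve
  have hJJ : ∀ x ∈ J₁, ∀ y ∈ J₂, ⁅x, y⁆ = 0 := by
    rintro _ ⟨x, rfl⟩ _ ⟨y, rfl⟩
    exact hcomm x y
  have hJJ' : ∀ y ∈ J₂, ∀ x ∈ J₁, ⁅y, x⁆ = 0 := fun y hy x hx => by
    rw [← lie_skew, hJJ x hx y hy, neg_zero]
  have hdec' : ∀ x, D.τ x = x → ∃ y ∈ J₁, ∃ z ∈ J₂, x = y + z := by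
    intro x hx
    obtain ⟨y, z, h⟩ := hdec x hx
    exact ⟨_, ⟨y, rfl⟩, _, ⟨z, rfl⟩, h⟩
  have hJ₁τ : ∀ x ∈ J₁, D.τ x = x := by
    rintro _ ⟨x, rfl⟩
    exact hτ₁ x
  have hJ₂τ : ∀ x ∈ J₂, D.τ x = x := by
    rintro _ ⟨x, rfl⟩
    exact hτ₂ x
  have hI₁ : ∀ x, D.τ x = x → ∀ y ∈ J₁, ⁅x, y⁆ ∈ J₁ := by
    intro x hx y hy
    obtain ⟨u, hu, v, hv, rfl⟩ := hdec' x hx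
    rw [add_lie, hJJ' v hv y hy, add_zero]
    exact hJ₁.lie_mem u hu y hy
  have hI₂ : ∀ x, D.τ x = x → ∀ y ∈ J₂, ⁅x, y⁆ ∈ J₂ := by
    intro x hx y hy
    obtain ⟨u, hu, v, hv, rfl⟩ := hdec' x hx
    rw [add_lie, hJJ u hu y hy, zero_add]
    exact hJ₂.lie_mem v hv y hy
  -- $\sigma J_1$ is again a simple ideal of $\mathfrak g^\tau=J_1\oplus J_2$. If not inside $J_1$,
  -- it would be all of $J_2$, of the wrong dimension, or would centralize both factors and be
  -- abelian.
  have hσ₁ : ∀ x ∈ J₁, D.σ x ∈ J₁ := by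
    let f₃ : su 2 →ₗ⁅ℝ⁆ 𝔤 := (D.σ : 𝔤 →ₗ⁅ℝ⁆ 𝔤).comp f₁
    have hf₃ : Function.Injective f₃ := D.σ.injective.comp hf₁
    let J₃ := LinearMap.range (f₃ : su 2 →ₗ[ℝ] 𝔤)
    have hJ₃ : IsSimpleSubspace J₃ := .of_injective f₃ hf₃
    have hd₃ : Module.finrank ℝ J₃ = 3 := by
      rw [← hd₁]
      exact (LinearMap.finrank_range_of_inj hf₃).trans (LinearMap.finrank_range_of_inj hf₁).symm
    have hJ₃τ : ∀ x ∈ J₃, D.τ x = x := by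
      rintro _ ⟨x, rfl⟩
      change D.τ (D.σ (f₁ x)) = D.σ (f₁ x)
      rw [← D.comm]
      exact congrArg D.σ (hτ₁ x)
    have hI₃ : ∀ x, D.τ x = x → ∀ y ∈ J₃, ⁅x, y⁆ ∈ J₃ := by
      rintro x hx _ ⟨y, rfl⟩
      obtain ⟨z, hz⟩ := hI₁ (D.σ x) (by rw [← D.comm, hx]) _ ⟨y, rfl⟩
      refine ⟨z, ?_⟩
      change D.σ (f₁ z) = ⁅x, D.σ (f₁ y)⁆
      have hz : f₁ z = ⁅D.σ x, f₁ y⁆ := hz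
      rw [hz, LieEquiv.map_lie, D.σ_invol]
    rcases hJ₃.le_or_lie_eq_zero (fun x hx w hw => hI₁ x (hJ₃τ x hx) w hw)
      (fun w hw x hx => hI₃ w (hJ₁τ w hw) x hx) with h | h
    · rintro _ ⟨x, rfl⟩
      exact h ⟨x, rfl⟩
    rcases hJ₃.le_or_lie_eq_zero (fun x hx w hw => hI₂ x (hJ₃τ x hx) w hw)
      (fun w hw x hx => hI₃ w (hJ₂τ w hw) x hx) with h' | h'
    · rcases hJ₂.eq_bot_or_eq J₃ h' (fun w hw x hx => hI₃ w (hJ₂τ w hw) x hx) with h'' | h''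
      · exact absurd h'' hJ₃.ne_bot
      · rw [h'', hd₂] at hd₃
        omega
    obtain ⟨x, hx, y, hy, hne⟩ := hJ₃.non_abelian
    obtain ⟨u, hu, v, hv, rfl⟩ := hdec' y (hJ₃τ y hy)
    rw [lie_add, h x hx u hu, h' x hx v hv, add_zero] at hne
    exact absurd rfl hne
  have hsplit : ∀ x, D.τ x = x → (∀ y ∈ J₁, ⁅y, x⁆ = 0) → x ∈ J₂ := by
    intro x hx h
    obtain ⟨u, hu, v, hv, rfl⟩ := hdec' x hx
    have : u = 0 := hJ₁.eq_zero_of_central hu fun y hy => by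
      have := h y hy
      rwa [lie_add, hJJ y hy v hv, add_zero] at this
    rwa [this, zero_add]
  have hσ₂ : ∀ x ∈ J₂, D.σ x ∈ J₂ := by
    intro x hx
    refine hsplit _ (by rw [← D.comm, hJ₂τ x hx]) fun y hy => ?_
    rw [← D.σ_invol y, ← LieEquiv.map_lie, hJJ _ (hσ₁ y hy) x hx, map_zero]
  -- For $x\in J$ the difference $x-\sigma x$ lies in $J\cap\mathfrak p_2$.
  have hfix : ∀ J : Submodule ℝ 𝔤, (∀ x ∈ J, D.τ x = x) → (∀ x ∈ J, D.σ x ∈ J) →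
      J ⊓ D.summand 4 = ⊥ → J ≤ D.𝔨.toSubmodule := by
    intro J hτ hσ h x hx
    have h1 : x - D.σ x ∈ J ⊓ D.summand 4 := by
      refine ⟨J.sub_mem hx (hσ x hx), D.mem_summand_four.2 ⟨?_, ?_⟩⟩
      · rw [map_sub, D.σ_invol, neg_sub]
      · exact hτ _ (J.sub_mem hx (hσ x hx))
    rw [h, Submodule.mem_bot, sub_eq_zero] at h1
    exact D.mem_𝔨.2 ⟨h1.symm, hτ x hx⟩
  have hirr : ∀ J : Submodule ℝ 𝔤, (∀ x, D.τ x = x → ∀ y ∈ J, ⁅x, y⁆ ∈ J) →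
      J ⊓ D.summand 4 = ⊥ ∨ D.summand 4 ≤ J := by
    intro J hJ
    refine (D.irred₂.2.2 (J ⊓ D.summand 4) inf_le_right fun x hx u hu =>
      ⟨hJ x (D.mem_𝔨.1 hx).2 u hu.1, D.irred₂.2.1 x hx u hu.2⟩).imp_right fun h => ?_
    exact inf_eq_right.1 h
  have h4 := D.finrank_summand_four hpos
  -- By irreducibility each ideal of $\mathfrak g^\tau$ contains $\mathfrak p_2$ or meets it in
  -- zero. Dimensions decide: $30>3$ for $J_1$, and $66>39$ shows that $J_2$ cannot lie in
  -- $\mathfrak k$.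
  have hJ₁k : J₁ ≤ D.𝔨.toSubmodule := by
    refine hfix J₁ hJ₁τ hσ₁ ((hirr J₁ hI₁).resolve_right fun h => ?_)
    have := Submodule.finrank_mono h
    omega
  have h4J : D.summand 4 ≤ J₂ := by
    refine (hirr J₂ hI₂).resolve_left fun h => ?_
    have := Submodule.finrank_mono (hfix J₂ hJ₂τ hσ₂ h)
    rw [hd₂, D.finrank_𝔨 hpos] at this
    omega
  -- $J_1$ is a simple ideal of $\mathfrak k=T\oplus A_1\oplus A_5$, and dimension 3 excludes $A_5$.
  have hJ₁V : J₁ = D.summand 1 := by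
    have hk : ∀ x ∈ D.𝔨, ∀ y ∈ J₁, ⁅x, y⁆ ∈ J₁ := fun x hx => hI₁ x (D.mem_𝔨.1 hx).2
    rcases hJ₁.le_or_lie_eq_zero (fun x hx w hw => D.lie_mem_summand_one (hJ₁k hx) hw)
      (fun w hw x hx => hk w (D.summand_one_le hw) x hx) with h | h
    · exact Submodule.eq_of_le_of_finrank_eq h (by rw [hd₁, D.finrank_summand_one])
    rcases hJ₁.le_or_lie_eq_zero (fun x hx w hw => D.lie_mem_summand_two (hJ₁k hx) hw)
      (fun w hw x hx => hk w (D.summand_two_le hw) x hx) with h' | h'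
    · rcases D.isSimpleSubspace_summand_two.eq_bot_or_eq J₁ h'
        (fun w hw x hx => hk w (D.summand_two_le hw) x hx) with h'' | h''
      · exact absurd h'' hJ₁.ne_bot
      · rw [h'', D.finrank_summand_two] at hd₁
        omega
    obtain ⟨x, hx, y, hy, hne⟩ := hJ₁.non_abelian
    have hyk := hJ₁k hy
    rw [𝔨_eq_sup] at hyk
    obtain ⟨w, hw, v, hv, rfl⟩ := Submodule.mem_sup.1 hyk
    obtain ⟨t, ht, u, hu, rfl⟩ := Submodule.mem_sup.1 hw
    rw [lie_add, lie_add, h x hx u hu, h' x hx v hv, (D.mem_summand_zero.1 ht).2 x (hJ₁k hx),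
      add_zero, add_zero] at hne
    exact absurd rfl hne
  -- $T$ and $A_5$ centralize $A_1=J_1$, and the centralizer of $J_1$ in $\mathfrak g^\tau$ is
  -- contained in $J_2$.
  refine ⟨J₂, hJ₂, hJ₂τ, fun x hx => ?_, fun x hx => ?_, h4J, fun x hx y hy => ?_⟩
  · exact hsplit x (D.mem_𝔨.1 (D.summand_zero_le hx)).2 fun y hy =>
      (D.mem_summand_zero.1 hx).2 y (hJ₁k hy)
  · exact hsplit x (D.mem_𝔨.1 (D.summand_two_le hx)).2 fun y hy =>
      D.lie_eq_zero_of_mem_one_of_mem_two (hJ₁V ▸ hy) hx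
  · exact hJJ x (hJ₁V ▸ hx) y hy

end

end

end E7II

/-! ### Symmetry and summation rules for the coefficients $(ijk)$ -/

section

variable {𝔤 : Type*} [LieRing 𝔤] [LieAlgebra ℝ 𝔤] {I : Type*} {V : I → Submodule ℝ 𝔤}
  (e : ∀ i, Module.Basis (Fin (Module.finrank ℝ (V i))) ℝ (V i))

theorem tripleCoeff_nonneg (i j k : I) : 0 ≤ tripleCoeff e i j k :=
  Finset.sum_nonneg fun _ _ => Finset.sum_nonneg fun _ _ => Finset.sum_nonneg fun _ _ =>
    sq_nonneg _

theorem tripleCoeff_swap_left (i j k : I) : tripleCoeff e i j k = tripleCoeff e j i k := by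
  unfold tripleCoeff
  rw [Finset.sum_comm]
  refine Finset.sum_congr rfl fun β _ => Finset.sum_congr rfl fun α _ =>
    Finset.sum_congr rfl fun γ _ => ?_
  rw [← lie_skew, map_neg, LinearMap.neg_apply, neg_sq]

theorem tripleCoeff_swap_right (i j k : I) : tripleCoeff e i j k = tripleCoeff e i k j := by
  unfold tripleCoeff
  refine Finset.sum_congr rfl fun α _ => ?_
  rw [Finset.sum_comm]
  refine Finset.sum_congr rfl fun γ _ => Finset.sum_congr rfl fun β _ => ?_
  rw [negKilling_lie_left', neg_sq, negKilling_comm]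

theorem tripleCoeff_eq_zero {i j k : I}
    (h : ∀ x ∈ V i, ∀ y ∈ V j, ∀ z ∈ V k, negKilling 𝔤 ⁅x, y⁆ z = 0) :
    tripleCoeff e i j k = 0 :=
  Finset.sum_eq_zero fun α _ => Finset.sum_eq_zero fun β _ => Finset.sum_eq_zero fun γ _ => by
    rw [h _ (e i α).2 _ (e j β).2 _ (e k γ).2, zero_pow two_ne_zero]

variable [DecidableEq I] (he : ∀ i, IsBOrthonormal (e i))
  (horth : ∀ i j, i ≠ j → ∀ x ∈ V i, ∀ y ∈ V j, negKilling 𝔤 x y = 0) (htop : ⨆ i, V i = ⊤)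

include he horth htop

/-- Orthonormal bases of orthogonal subspaces spanning `𝔤` make up an orthonormal basis of `𝔤`. -/
theorem exists_orthonormal_basis :
    ∃ b : Module.Basis (Σ i, Fin (Module.finrank ℝ (V i))) ℝ 𝔤,
      (∀ p, b p = e p.1 p.2) ∧ ∀ p q, negKilling 𝔤 (b p) (b q) = if p = q then 1 else 0 := by
  let v : (Σ i, Fin (Module.finrank ℝ (V i))) → 𝔤 := fun p => e p.1 p.2
  have hv : ∀ p q, negKilling 𝔤 (v p) (v q) = if p = q then 1 else 0 := by
    rintro ⟨i, α⟩ ⟨j, β⟩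
    by_cases hij : i = j
    · subst hij
      refine (he i α β).trans ?_
      simp
    · rw [if_neg (fun h => hij (congrArg Sigma.fst h))]
      exact horth i j hij _ (e i α).2 _ (e j β).2
  have hli : LinearIndependent ℝ v := by
    refine LinearMap.BilinForm.linearIndependent_of_iIsOrtho (B := negKilling 𝔤)
      (fun p q hpq => ?_) fun p hp => ?_
    · exact (hv p q).trans (if_neg hpq)
    · have h := hv p p
      rw [if_pos rfl] at h
      exact one_ne_zero (h.symm.trans hp)
  have hspan : ⊤ ≤ Submodule.span ℝ (Set.range v) := by
    rw [← htop]
    refine iSup_le fun i x hx => ?_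
    have h := (e i).sum_repr ⟨x, hx⟩
    have h2 := congrArg Subtype.val h
    rw [← show _ = x from h2, AddSubmonoidClass.coe_finsetSum]
    exact Submodule.sum_mem _ fun α _ => Submodule.smul_mem _ _
      (Submodule.subset_span ⟨⟨i, α⟩, rfl⟩)
  refine ⟨Module.Basis.mk hli hspan, fun p => Module.Basis.mk_apply hli hspan p, fun p q => ?_⟩
  rw [Module.Basis.mk_apply, Module.Basis.mk_apply, hv]

variable [Fintype I]

/-- Sum `twistedForm_self_eq_sum` over the orthonormal basis of $V_i$; each basis vector contributes
$c$. -/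
theorem sum_mul_tripleCoeff_of_twistedForm {s : 𝔤 ≃ₗ⁅ℝ⁆ 𝔤} {ε : I → ℝ}
    (hs : ∀ i, ∀ x ∈ V i, s x = ε i • x) {c : ℝ} {i : I}
    (hc : ∀ x ∈ V i, twistedForm s x x = c * negKilling 𝔤 x x) :
    ∑ j, ∑ k, ε j * tripleCoeff e i j k = c * Module.finrank ℝ (V i) := by
  obtain ⟨b, hbe, hb⟩ := exists_orthonormal_basis e he horth htop
  have h1 : ∀ α, ∑ j, ∑ β, ε j * ∑ k, ∑ γ,
      negKilling 𝔤 ⁅(e i α : 𝔤), (e j β : 𝔤)⁆ (e k γ : 𝔤) ^ 2 = c := by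
    intro α
    have h2 := twistedForm_self_eq_sum b hb (ε := fun p => ε p.1)
      (fun p => hs p.1 _ (by rw [hbe]; exact (e p.1 p.2).2)) (e i α : 𝔤)
    have h3 : negKilling 𝔤 (e i α : 𝔤) (e i α : 𝔤) = 1 := (he i α α).trans (if_pos rfl)
    rw [hc _ (e i α).2, h3, mul_one, Fintype.sum_sigma] at h2
    simp only [Fintype.sum_sigma, hbe] at h2
    exact h2.symm
  have h4 : ∑ α : Fin (Module.finrank ℝ (V i)), c = c * Module.finrank ℝ (V i) := by
    simp [mul_comm]
  have h5 : ∀ j, ∑ k, ε j * tripleCoeff e i j k = ∑ α, ∑ β, ε j * ∑ k, ∑ γ,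
      negKilling 𝔤 ⁅(e i α : 𝔤), (e j β : 𝔤)⁆ (e k γ : 𝔤) ^ 2 := by
    intro j
    simp only [← Finset.mul_sum]
    congr 1
    unfold tripleCoeff
    rw [Finset.sum_comm]
    exact Finset.sum_congr rfl fun α _ => Finset.sum_comm
  rw [← h4, ← Finset.sum_congr rfl fun α _ => h1 α, Finset.sum_congr rfl fun j _ => h5 j,
    Finset.sum_comm]

theorem sum_tripleCoeff (i : I) :
    ∑ j, ∑ k, tripleCoeff e i j k = Module.finrank ℝ (V i) := by
  have h := sum_mul_tripleCoeff_of_twistedForm e he horth htop (s := LieEquiv.refl)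
    (ε := fun _ => 1) (c := 1) (i := i) (fun i x _ => (one_smul ℝ x).symm) (fun x _ => by
      obtain ⟨b, -, hb⟩ := exists_orthonormal_basis e he horth htop
      rw [one_mul, negKilling_self_eq_sum b hb, twistedForm_self_eq_sum b hb (ε := fun _ => 1)
        (fun p => (one_smul ℝ _).symm)]
      simp only [one_mul])
  simpa only [one_mul] using h

/-- Parseval for $[e_\alpha,e_\beta]$. It is applied with $V_i=T$, where the hypothesis says that
$(\mathrm{ad}\,t)^2$ is scalar on $V_j$. -/
theorem sum_tripleCoeff_of_sq_lie {i j : I} {l : ℝ}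
    (hl : ∀ x ∈ V i, ∀ y ∈ V j,
      negKilling 𝔤 ⁅x, y⁆ ⁅x, y⁆ = l * negKilling 𝔤 x x * negKilling 𝔤 y y) :
    ∑ k, tripleCoeff e i j k = Module.finrank ℝ (V i) * Module.finrank ℝ (V j) * l := by
  obtain ⟨b, hbe, hb⟩ := exists_orthonormal_basis e he horth htop
  have h1 : ∀ α β, ∑ k, ∑ γ, negKilling 𝔤 ⁅(e i α : 𝔤), (e j β : 𝔤)⁆ (e k γ : 𝔤) ^ 2 = l := by
    intro α β
    have h2 := hl _ (e i α).2 _ (e j β).2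
    have h3 : negKilling 𝔤 (e i α : 𝔤) (e i α : 𝔤) = 1 := (he i α α).trans (if_pos rfl)
    have h4 : negKilling 𝔤 (e j β : 𝔤) (e j β : 𝔤) = 1 := (he j β β).trans (if_pos rfl)
    rw [h3, h4, mul_one, mul_one, negKilling_eq_sum b hb, Fintype.sum_sigma] at h2
    simp only [hbe, ← pow_two] at h2
    exact h2
  unfold tripleCoeff
  rw [Finset.sum_comm]
  have h5 : ∀ α, ∑ k, ∑ β, ∑ γ, negKilling 𝔤 ⁅(e i α : 𝔤), (e j β : 𝔤)⁆ (e k γ : 𝔤) ^ 2 =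
      Module.finrank ℝ (V j) * l := by
    intro α
    rw [Finset.sum_comm, Finset.sum_congr rfl fun β _ => h1 α β]
    simp
  rw [Finset.sum_congr rfl fun α _ => h5 α]
  simp [mul_assoc]

end

/-! ### Vanishing coefficients and the scalars given by Schur's lemma -/

namespace E7II

variable {𝔤 : Type*} [LieRing 𝔤] [LieAlgebra ℝ 𝔤] (D : E7II 𝔤)

/-- The sign by which `σ` acts on the `i`-th summand. -/
def signσ : Fin 6 → ℤ := ![1, 1, 1, 1, -1, -1]

/-- The sign by which `τ` acts on the `i`-th summand. -/
def signτ : Fin 6 → ℤ := ![1, 1, 1, -1, 1, -1]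

theorem σ_apply_of_mem {i : Fin 6} {x : 𝔤} (hx : x ∈ D.summand i) :
    D.σ x = (signσ i : ℝ) • x := by
  fin_cases i
  · simpa [signσ] using (D.mem_𝔨.1 (D.summand_zero_le hx)).1
  · simpa [signσ] using (D.mem_𝔨.1 (D.summand_one_le hx)).1
  · simpa [signσ] using (D.mem_𝔨.1 (D.summand_two_le hx)).1
  · simpa [signσ] using (D.mem_summand_three.1 hx).1
  · simpa [signσ] using (D.mem_summand_four.1 hx).1
  · simpa [signσ] using (D.mem_summand_five.1 hx).1

theorem τ_apply_of_mem {i : Fin 6} {x : 𝔤} (hx : x ∈ D.summand i) :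
    D.τ x = (signτ i : ℝ) • x := by
  fin_cases i
  · simpa [signτ] using (D.mem_𝔨.1 (D.summand_zero_le hx)).2
  · simpa [signτ] using (D.mem_𝔨.1 (D.summand_one_le hx)).2
  · simpa [signτ] using (D.mem_𝔨.1 (D.summand_two_le hx)).2
  · simpa [signτ] using (D.mem_summand_three.1 hx).2
  · simpa [signτ] using (D.mem_summand_four.1 hx).2
  · simpa [signτ] using (D.mem_summand_five.1 hx).2

theorem negKilling_lie_eq_zero_of_sign {s : 𝔤 ≃ₗ⁅ℝ⁆ 𝔤} {a b c : ℤ} (h : a * b * c ≠ 1) {x y z : 𝔤}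
    (hx : s x = (a : ℝ) • x) (hy : s y = (b : ℝ) • y) (hz : s z = (c : ℝ) • z) :
    negKilling 𝔤 ⁅x, y⁆ z = 0 := by
  have h1 := negKilling_map s ⁅x, y⁆ z
  rw [LieEquiv.map_lie, hx, hy, hz, smul_lie, lie_smul, map_smul, map_smul, map_smul,
    LinearMap.smul_apply, LinearMap.smul_apply, smul_eq_mul, smul_eq_mul, smul_eq_mul] at h1
  have h2 : ((a : ℝ) * b * c - 1) * negKilling 𝔤 ⁅x, y⁆ z = 0 := by linear_combination h1
  refine (mul_eq_zero.1 h2).resolve_left fun h3 => h ?_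
  exact_mod_cast sub_eq_zero.1 h3

theorem lie_eq_zero_of_le_two {i j : Fin 6} (hi : i ≤ 2) (hj : j ≤ 2) (hij : i = 0 ∨ i ≠ j)
    {x y : 𝔤} (hx : x ∈ D.summand i) (hy : y ∈ D.summand j) : ⁅x, y⁆ = 0 := by
  have hk : ∀ i : Fin 6, i ≤ 2 → ∀ z ∈ D.summand i, z ∈ D.𝔨 := by
    intro i hi z hz
    obtain rfl | rfl | rfl : i = 0 ∨ i = 1 ∨ i = 2 := by clear hz; revert i; decide
    · exact D.summand_zero_le hz
    · exact D.summand_one_le hz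
    · exact D.summand_two_le hz
  have h0 : ∀ z ∈ D.summand 0, ∀ w ∈ D.𝔨, ⁅w, z⁆ = 0 := fun z hz w hw =>
    (D.mem_summand_zero.1 hz).2 w hw
  obtain rfl | rfl | ⟨rfl, rfl⟩ | ⟨rfl, rfl⟩ :
      i = 0 ∨ j = 0 ∨ (i = 1 ∧ j = 2) ∨ (i = 2 ∧ j = 1) := by
    clear hx hy
    revert i j
    decide
  · rw [← lie_skew, h0 x hx y (hk j hj y hy), neg_zero]
  · exact h0 y hy x (hk i hi x hx)
  · exact D.lie_eq_zero_of_mem_one_of_mem_two hx hy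
  · rw [← lie_skew, D.lie_eq_zero_of_mem_one_of_mem_two hy hx, neg_zero]

variable (e : ∀ i : Fin 6, Module.Basis (Fin (Module.finrank ℝ (D.summand i))) ℝ (D.summand i))

theorem tripleCoeff_eq_zero_of_not_mem (i j k : Fin 6)
    (h : ({i, j, k} : Multiset (Fin 6)) ∉
        ({{0, 3, 3}, {0, 4, 4}, {0, 5, 5}, {1, 1, 1}, {1, 3, 3}, {1, 4, 4}, {1, 5, 5},
          {2, 2, 2}, {2, 3, 3}, {2, 4, 4}, {2, 5, 5}, {3, 4, 5}} : Set (Multiset (Fin 6)))) :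
    tripleCoeff e i j k = 0 := by
  -- An unlisted triple violates a sign rule or contains two commuting summands of $\mathfrak k$;
  -- the alternative `i = 0` covers the abelian pair $(0,0)$. Integer signs make this a finite
  -- check.
  have hcomb : signσ i * signσ j * signσ k ≠ 1 ∨ signτ i * signτ j * signτ k ≠ 1 ∨
      (i ≤ 2 ∧ j ≤ 2 ∧ (i = 0 ∨ i ≠ j)) ∨ (i ≤ 2 ∧ k ≤ 2 ∧ (i = 0 ∨ i ≠ k)) ∨
      (j ≤ 2 ∧ k ≤ 2 ∧ (j = 0 ∨ j ≠ k)) := by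
    simp only [Set.mem_insert_iff, Set.mem_singleton_iff] at h
    revert i j k
    decide +kernel
  rcases hcomb with hc | hc | ⟨hi, hj, hc⟩ | ⟨hi, hj, hc⟩ | ⟨hi, hj, hc⟩
  · exact tripleCoeff_eq_zero e fun x hx y hy z hz => negKilling_lie_eq_zero_of_sign hc
      (D.σ_apply_of_mem hx) (D.σ_apply_of_mem hy) (D.σ_apply_of_mem hz)
  · exact tripleCoeff_eq_zero e fun x hx y hy z hz => negKilling_lie_eq_zero_of_sign hc
      (D.τ_apply_of_mem hx) (D.τ_apply_of_mem hy) (D.τ_apply_of_mem hz)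
  · refine tripleCoeff_eq_zero e fun x hx y hy z hz => ?_
    rw [D.lie_eq_zero_of_le_two hi hj hc hx hy, map_zero, LinearMap.zero_apply]
  · rw [tripleCoeff_swap_right]
    refine tripleCoeff_eq_zero e fun x hx y hy z hz => ?_
    rw [D.lie_eq_zero_of_le_two hi hj hc hx hy, map_zero, LinearMap.zero_apply]
  · rw [tripleCoeff_swap_left, tripleCoeff_swap_right]
    refine tripleCoeff_eq_zero e fun x hx y hy z hz => ?_
    rw [D.lie_eq_zero_of_le_two hi hj hc hx hy, map_zero, LinearMap.zero_apply]

section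

variable [FiniteDimensional ℝ 𝔤] (hpos : ∀ x : 𝔤, x ≠ 0 → 0 < negKilling 𝔤 x x)

include hpos

theorem exists_twistedForm_σ_eq : ∃ c : ℝ, ∀ x ∈ (fixedSubalgebra D.σ).toSubmodule,
    twistedForm D.σ x x = c * negKilling 𝔤 x x := by
  have hJ := D.isSimpleSubspace_fixed_σ
  obtain ⟨c, hc⟩ := exists_eq_mul_of_irreducible (fixedSubalgebra D.σ : Set 𝔤) _ hJ.ne_bot
    hJ.lie_mem hJ.eq_bot_or_eq (negKilling 𝔤) (twistedForm D.σ) negKilling_comm hpos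
    (fun v hv w _ => twistedForm_comm hv w) (fun x _ v _ w _ => negKilling_lie_left' x v w)
    (fun x hx v _ w _ => twistedForm_lie_left hx v w)
  exact ⟨c, fun x hx => hc x hx x hx⟩

/-- $T$, $A_5$ and $\mathfrak p_2$ share one constant because they lie in the simple ideal
$\mathfrak{so}(12)$. Schur's lemma there says nothing about $A_1$, which is the other ideal. -/
theorem exists_twistedForm_τ_eq : ∃ c : ℝ,
    ∀ x, x ∈ D.summand 0 ∨ x ∈ D.summand 2 ∨ x ∈ D.summand 4 →
      twistedForm D.τ x x = c * negKilling 𝔤 x x := by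
  obtain ⟨J, hJ, hJτ, h0, h2, h4, -⟩ := D.exists_simple_of_fixed_τ hpos
  obtain ⟨c, hc⟩ := exists_eq_mul_of_irreducible (J : Set 𝔤) _ hJ.ne_bot
    hJ.lie_mem hJ.eq_bot_or_eq (negKilling 𝔤) (twistedForm D.τ) negKilling_comm hpos
    (fun v hv w _ => twistedForm_comm (hJτ hv) w)
    (fun x _ v _ w _ => negKilling_lie_left' x v w)
    (fun x hx v _ w _ => twistedForm_lie_left (hJτ hx) v w)
  refine ⟨c, fun x hx => ?_⟩
  have hx : x ∈ J := by
    rcases hx with hx | hx | hx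
    exacts [h0 hx, h2 hx, h4 hx]
  exact hc x hx x hx

theorem tripleCoeff_one_four_four : tripleCoeff e 1 4 4 = 0 := by
  obtain ⟨J, -, -, -, -, h4, h1⟩ := D.exists_simple_of_fixed_τ hpos
  refine tripleCoeff_eq_zero e fun x hx y hy z hz => ?_
  rw [h1 x hx y (h4 hy), map_zero, LinearMap.zero_apply]

/-- The square of the adjoint action of a central element of `𝔨` is a scalar on every irreducible
`𝔨`-module. -/
theorem exists_lie_lie_eq {W : Submodule ℝ 𝔤} (hW : IsIrreducibleUnder D.𝔨 W) {t : 𝔤}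
    (ht : t ∈ D.summand 0) : ∃ l : ℝ, ∀ x ∈ W, ⁅t, ⁅t, x⁆⁆ = -l • x := by
  obtain ⟨htk, ht⟩ := D.mem_summand_zero.1 ht
  have hcomm : ∀ x ∈ D.𝔨, ∀ v : 𝔤, ⁅t, ⁅x, v⁆⁆ = ⁅x, ⁅t, v⁆⁆ := fun x hx v => by
    have h : ⁅t, x⁆ = 0 := by rw [← lie_skew, ht x hx, neg_zero]
    rw [leibniz_lie t x v, h, zero_lie, zero_add]
  obtain ⟨l, hl⟩ := exists_eq_mul_of_irreducible (D.𝔨 : Set 𝔤) W hW.1 hW.2.1 hW.2.2 (negKilling 𝔤)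
    ((negKilling 𝔤).compl₁₂ (LieAlgebra.ad ℝ 𝔤 t) (LieAlgebra.ad ℝ 𝔤 t)) negKilling_comm hpos
    (fun v _ w _ => negKilling_comm _ _) (fun x _ v _ w _ => negKilling_lie_left' x v w)
    (fun x hx v _ w _ => by
      change negKilling 𝔤 ⁅t, ⁅x, v⁆⁆ ⁅t, w⁆ = -negKilling 𝔤 ⁅t, v⁆ ⁅t, ⁅x, w⁆⁆
      rw [hcomm x hx, hcomm x hx, negKilling_lie_left'])
  refine ⟨l, fun x hx => ?_⟩
  have hl' : ∀ w ∈ W, negKilling 𝔤 (⁅t, ⁅t, x⁆⁆ + l • x) w = 0 := by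
    intro w hw
    have h1 : negKilling 𝔤 ⁅t, x⁆ ⁅t, w⁆ = l * negKilling 𝔤 x w := hl x hx w hw
    rw [map_add, LinearMap.add_apply, negKilling_lie_left', h1, map_smul, LinearMap.smul_apply,
      smul_eq_mul, neg_add_cancel]
  have hmem : ⁅t, ⁅t, x⁆⁆ + l • x ∈ W :=
    W.add_mem (hW.2.1 t htk _ (hW.2.1 t htk x hx)) (W.smul_mem l hx)
  rw [neg_smul, ← add_eq_zero_iff_eq_neg]
  by_contra hne
  exact (hpos _ hne).ne' (hl' _ hmem)

end

/-- If `(ad t) ^ 2` is the scalar `-l`, `-m`, `-n` on subspaces `U`, `V`, `W` with `⁅U, V⁆ ≤ W`, where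
`U` and `V` are stable under `ad t` and do not commute, then `√l ± √m = ± √n`. -/
theorem four_mul_eq_sq_of_lie_ne_zero {U V W : Submodule ℝ 𝔤} {t : 𝔤} {l m n : ℝ}
    (hU : ∀ x ∈ U, ⁅t, ⁅t, x⁆⁆ = -l • x) (hV : ∀ x ∈ V, ⁅t, ⁅t, x⁆⁆ = -m • x)
    (hW : ∀ x ∈ W, ⁅t, ⁅t, x⁆⁆ = -n • x) (hUt : ∀ x ∈ U, ⁅t, x⁆ ∈ U) (hVt : ∀ x ∈ V, ⁅t, x⁆ ∈ V)
    (hUV : ∀ x ∈ U, ∀ y ∈ V, ⁅x, y⁆ ∈ W) {x y : 𝔤} (hx : x ∈ U) (hy : y ∈ V) (hxy : ⁅x, y⁆ ≠ 0) :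
    4 * l * m = (l + m - n) ^ 2 := by
  -- Leibniz expansion of $(\mathrm{ad}\,t)^2[x,y]=-n[x,y]$. Applying it again to $[t,x],[t,y]$
  -- leads back to a multiple of $[x,y]$.
  have key : ∀ x ∈ U, ∀ y ∈ V, (2 : ℝ) • ⁅⁅t, x⁆, ⁅t, y⁆⁆ = (l + m - n) • ⁅x, y⁆ := by
    intro x hx y hy
    have h := hW _ (hUV x hx y hy)
    rw [leibniz_lie t x y, lie_add, leibniz_lie t ⁅t, x⁆ y, leibniz_lie t x ⁅t, y⁆, hU x hx,
      hV y hy, smul_lie, lie_smul] at h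
    linear_combination (norm := module) h
  have h1 := key x hx y hy
  have h2 := key _ (hUt x hx) _ (hVt y hy)
  rw [hU x hx, hV y hy, smul_lie, lie_smul] at h2
  have h3 : (4 * l * m - (l + m - n) ^ 2) • ⁅x, y⁆ = 0 := by
    linear_combination (norm := module) (2 : ℝ) • h2 + (l + m - n) • h1
  exact sub_eq_zero.1 ((smul_eq_zero.1 h3).resolve_right hxy)

end E7II

/-! ### Solving the relations and conclusion -/

namespace E7II

/-- The linear relations between the numbers `(ijk)` coming from the invariance of the Killing form,
together with the relation between the eigenvalues of the center of `𝔨`, have only one solution. -/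
theorem solve_relations {n : ℕ} {g b l m k x033 x044 x055 x345 x111 x133 x155 : ℝ}
    {x222 x233 x244 x255 : ℝ}
    (r0 : x033 + x044 + x055 = 1) (r1 : x111 + x133 + x155 = 3)
    (r2 : x222 + x233 + x244 + x255 = 35) (r3 : 2 * (x033 + x133 + x233) + 2 * x345 = 24)
    (r4 : 2 * (x044 + x244) + 2 * x345 = 30) (r5 : 2 * (x055 + x155 + x255) + 2 * x345 = n)
    (s0 : x033 = g) (s1 : x111 + x133 = 3 * g) (s2 : x222 + x233 = 35 * g)
    (s3 : 2 * (x033 + x133 + x233) = 24 * g)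
    (t0 : x044 = b) (t2 : x222 + x244 = 35 * b) (t4 : 2 * (x044 + x244) = 30 * b)
    (hl : x033 = 24 * l) (hm : x044 = 30 * m) (hk : x055 = n * k)
    (h055 : 0 ≤ x055) (h111 : 0 ≤ x111)
    (hlmk : x345 ≠ 0 → 4 * l * m = (l + m - k) ^ 2) :
    (x033 = 4 / 9 ∧ x044 = 5 / 9 ∧ x055 = 0 ∧ x345 = 20 / 3) ∧
    (x111 = 1 / 3 ∧ x133 = 1 ∧ x155 = 5 / 3) ∧
    (x222 = 35 / 3 ∧ x233 = 35 / 9 ∧ x244 = 70 / 9 ∧ x255 = 35 / 3) := by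
  have hg : g = (96 - n) / 126 := by linarith
  have hb : b = 1 / 5 + 4 / 5 * g := by linarith
  have hx055 : x055 = 4 / 5 - 9 / 5 * g := by linarith
  have hx111 : x111 = 51 / 5 * g - 21 / 5 := by linarith
  have hx345 : x345 = 12 - 12 * g := by linarith
  -- $x_{055}\ge0$ means $g\le4/9$, that is $n\ge40$; $x_{111}\ge0$ means $g\ge7/17$, that is
  -- $n<45$.
  have hn1 : 40 ≤ n := by
    have : (40 : ℝ) ≤ n := by linarith
    exact_mod_cast this
  have hn2 : n ≤ 44 := by
    have : (n : ℝ) < 45 := by linarith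
    have : n < 45 := by exact_mod_cast this
    omega
  have h345 : x345 ≠ 0 := by
    have : (40 : ℝ) ≤ n := by exact_mod_cast hn1
    intro h
    linarith
  have hq := hlmk h345
  -- All of $l,m,k$ are now explicit in $n$, and the quadratic relation fails for $n=41,\dots,44$.
  have hn : n = 40 := by
    have hl' : l = g / 24 := by linarith
    have hm' : m = b / 30 := by linarith
    have hn0 : (n : ℝ) ≠ 0 := by
      have : n ≠ 0 := by omega
      exact_mod_cast this
    have hk' : k = x055 / n := by rw [hk]; field_simp
    rw [hl', hm', hk', hx055, hb, hg] at hq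
    clear * - hn1 hn2 hq
    interval_cases n <;> first | rfl | (exfalso; norm_num at hq)
  subst hn
  norm_num at hg
  subst hg
  refine ⟨⟨?_, ?_, ?_, ?_⟩, ⟨?_, ?_, ?_⟩, ?_, ?_, ?_, ?_⟩ <;> linarith

variable {𝔤 : Type*} [LieRing 𝔤] [LieAlgebra ℝ 𝔤] [FiniteDimensional ℝ 𝔤] (D : E7II 𝔤)
  (hpos : ∀ x : 𝔤, x ≠ 0 → 0 < negKilling 𝔤 x x)
  (e : ∀ i : Fin 6, Module.Basis (Fin (Module.finrank ℝ (D.summand i))) ℝ (D.summand i))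
  (he : ∀ i, IsBOrthonormal (e i))

include hpos he

/-- The center of `𝔨` acts on `𝔭₁`, `𝔭₂`, `𝔭₃` by complex structures up to scalars, and these are
compatible with the bracket `𝔭₁ × 𝔭₂ → 𝔭₃`. -/
theorem exists_center_scalars : ∃ l m n : ℝ,
    tripleCoeff e 0 3 3 = 24 * l ∧ tripleCoeff e 0 4 4 = 30 * m ∧
    tripleCoeff e 0 5 5 = Module.finrank ℝ (D.summand 5) * n ∧
    (tripleCoeff e 3 4 5 ≠ 0 → 4 * l * m = (l + m - n) ^ 2) := by
  have hz := D.tripleCoeff_eq_zero_of_not_mem e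
  have : Nonempty (Fin (Module.finrank ℝ (D.summand 0))) := by
    rw [D.finrank_summand_zero]
    exact ⟨0⟩
  let α : Fin (Module.finrank ℝ (D.summand 0)) := Classical.arbitrary _
  have hsub : ∀ β, β = α := fun β => by
    have : Subsingleton (Fin (Module.finrank ℝ (D.summand 0))) := by
      rw [D.finrank_summand_zero]
      infer_instance
    exact Subsingleton.elim _ _
  let t : 𝔤 := e 0 α
  have ht : t ∈ D.summand 0 := (e 0 α).2
  have ht1 : negKilling 𝔤 t t = 1 := (he 0 α α).trans (if_pos rfl)
  have hspan : ∀ z ∈ D.summand 0, ∃ c : ℝ, z = c • t := by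
    intro z hz
    refine ⟨(e 0).repr ⟨z, hz⟩ α, ?_⟩
    have h := congrArg Subtype.val ((e 0).sum_repr ⟨z, hz⟩)
    rw [Fintype.sum_eq_single α (fun β hβ => absurd (hsub β) hβ)] at h
    exact h.symm
  -- For $i\ge3$ only $(0ii)$ survives in this sum, so the scalar determines that coefficient.
  have hrow : ∀ (i : Fin 6) (l : ℝ), (∀ x ∈ D.summand i, ⁅t, ⁅t, x⁆⁆ = -l • x) →
      ∑ k, tripleCoeff e 0 i k = Module.finrank ℝ (D.summand i) * l := by
    intro i l hl
    have h := sum_tripleCoeff_of_sq_lie e he (fun i j hij x hx y hy =>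
      D.negKilling_summand_eq_zero' hij hx hy) D.iSup_summand (i := 0) (j := i) (l := l) ?_
    · rw [h, D.finrank_summand_zero, Nat.cast_one, one_mul]
    · intro z hz x hx
      obtain ⟨c, rfl⟩ := hspan z hz
      have h1 : negKilling 𝔤 ⁅t, x⁆ ⁅t, x⁆ = l * negKilling 𝔤 x x := by
        rw [negKilling_lie_left', hl x hx, map_smul, smul_eq_mul]
        ring
      simp only [smul_lie, map_smul, LinearMap.smul_apply, smul_eq_mul, h1, ht1]
      ring
  obtain ⟨l, hl⟩ := D.exists_lie_lie_eq hpos D.irred₁ ht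
  obtain ⟨m, hm⟩ := D.exists_lie_lie_eq hpos D.irred₂ ht
  obtain ⟨n, hn⟩ := D.exists_lie_lie_eq hpos D.irred₃ ht
  have htk := D.summand_zero_le ht
  refine ⟨l, m, n, ?_, ?_, ?_, fun hne => ?_⟩
  · have h := hrow 3 l hl
    simp (disch := decide +kernel) only [Fin.sum_univ_six, hz, D.finrank_summand_three hpos] at h
    simpa using h
  · have h := hrow 4 m hm
    simp (disch := decide +kernel) only [Fin.sum_univ_six, hz, D.finrank_summand_four hpos] at h
    simpa using h
  · have h := hrow 5 n hn
    simp (disch := decide +kernel) only [Fin.sum_univ_six, hz] at h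
    simpa using h
  · obtain ⟨x, hx, y, hy, hxy⟩ : ∃ x ∈ D.summand 3, ∃ y ∈ D.summand 4, ⁅x, y⁆ ≠ 0 := by
      by_contra! h
      exact hne (tripleCoeff_eq_zero e fun x hx y hy z _ => by
        rw [h x hx y hy, map_zero, LinearMap.zero_apply])
    refine four_mul_eq_sq_of_lie_ne_zero hl hm hn (D.irred₁.2.1 t htk) (D.irred₂.2.1 t htk)
      (fun u hu v hv => D.mem_summand_five.2 ?_) hx hy hxy
    have hu := D.mem_summand_three.1 hu
    have hv := D.mem_summand_four.1 hv
    rw [LieEquiv.map_lie, LieEquiv.map_lie, hu.1, hu.2, hv.1, hv.2, lie_neg, neg_lie]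
    exact ⟨rfl, rfl⟩

end E7II

theorem lemma3p5 {𝔤 : Type*} [LieRing 𝔤] [LieAlgebra ℝ 𝔤] [FiniteDimensional ℝ 𝔤]
    (h𝔤 : IsCompactE7 𝔤) (D : E7II 𝔤)
    (e : ∀ i : Fin 6, Module.Basis (Fin (Module.finrank ℝ (D.summand i))) ℝ (D.summand i))
    (he : ∀ i, IsBOrthonormal (e i)) :
    (tripleCoeff e 0 3 3 = 4 / 9 ∧ tripleCoeff e 0 4 4 = 5 / 9 ∧ tripleCoeff e 0 5 5 = 0 ∧
      tripleCoeff e 3 4 5 = 20 / 3) ∧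
    (tripleCoeff e 1 1 1 = 1 / 3 ∧ tripleCoeff e 1 3 3 = 1 ∧ tripleCoeff e 1 4 4 = 0 ∧
      tripleCoeff e 1 5 5 = 5 / 3) ∧
    (tripleCoeff e 2 2 2 = 35 / 3 ∧ tripleCoeff e 2 3 3 = 35 / 9 ∧
      tripleCoeff e 2 4 4 = 70 / 9 ∧ tripleCoeff e 2 5 5 = 35 / 3) ∧
    (∀ i j k : Fin 6,
      ({i, j, k} : Multiset (Fin 6)) ∉
        ({{0, 3, 3}, {0, 4, 4}, {0, 5, 5}, {1, 1, 1}, {1, 3, 3}, {1, 4, 4}, {1, 5, 5},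
          {2, 2, 2}, {2, 3, 3}, {2, 4, 4}, {2, 5, 5}, {3, 4, 5}} : Set (Multiset (Fin 6))) →
      tripleCoeff e i j k = 0) := by
  have hpos : ∀ x : 𝔤, x ≠ 0 → 0 < negKilling 𝔤 x x := fun x hx => h𝔤.negKilling_pos hx
  have hz := D.tripleCoeff_eq_zero_of_not_mem e
  have h144 := D.tripleCoeff_one_four_four e hpos
  have horth : ∀ i j, i ≠ j → ∀ x ∈ D.summand i, ∀ y ∈ D.summand j, negKilling 𝔤 x y = 0 :=
    fun i j hij x hx y hy => D.negKilling_summand_eq_zero' hij hx hy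
  have hrow := sum_tripleCoeff e he horth D.iSup_summand
  obtain ⟨c, hc⟩ := D.exists_twistedForm_σ_eq hpos
  obtain ⟨d, hd⟩ := D.exists_twistedForm_τ_eq hpos
  have hσ : ∀ i : Fin 6, D.summand i ≤ (fixedSubalgebra D.σ).toSubmodule →
      ∑ j, ∑ k, (E7II.signσ j : ℝ) * tripleCoeff e i j k =
        c * Module.finrank ℝ (D.summand i) := fun i hi =>
    sum_mul_tripleCoeff_of_twistedForm e he horth D.iSup_summand
      (fun i x hx => D.σ_apply_of_mem hx) fun x hx => hc x (hi hx)
  have hτ : ∀ i : Fin 6, (∀ x ∈ D.summand i,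
        x ∈ D.summand 0 ∨ x ∈ D.summand 2 ∨ x ∈ D.summand 4) →
      ∑ j, ∑ k, (E7II.signτ j : ℝ) * tripleCoeff e i j k =
        d * Module.finrank ℝ (D.summand i) := fun i hi =>
    sum_mul_tripleCoeff_of_twistedForm e he horth D.iSup_summand
      (fun i x hx => D.τ_apply_of_mem hx) fun x hx => hd x (hi x hx)
  have hA : ∀ i j, tripleCoeff e j i j = tripleCoeff e i j j := fun i j =>
    tripleCoeff_swap_left e _ _ _
  have hB : ∀ i j, tripleCoeff e j j i = tripleCoeff e i j j := fun i j => by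
    rw [tripleCoeff_swap_right, hA]
  have h354 : tripleCoeff e 3 5 4 = tripleCoeff e 3 4 5 := tripleCoeff_swap_right e _ _ _
  have h435 : tripleCoeff e 4 3 5 = tripleCoeff e 3 4 5 := tripleCoeff_swap_left e _ _ _
  have h453 : tripleCoeff e 4 5 3 = tripleCoeff e 3 4 5 := by rw [tripleCoeff_swap_right, h435]
  have h534 : tripleCoeff e 5 3 4 = tripleCoeff e 3 4 5 := by rw [tripleCoeff_swap_left, h354]
  have h543 : tripleCoeff e 5 4 3 = tripleCoeff e 3 4 5 := by rw [tripleCoeff_swap_left, h453]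
  have hkσ : ∀ i, D.summand i ≤ D.𝔨.toSubmodule →
      D.summand i ≤ (fixedSubalgebra D.σ).toSubmodule := fun i hi x hx => (D.mem_𝔨.1 (hi hx)).1
  have hr0 := hrow 0
  have hr1 := hrow 1
  have hr2 := hrow 2
  have hr3 := hrow 3
  have hr4 := hrow 4
  have hr5 := hrow 5
  have hs0 := hσ 0 (hkσ 0 D.summand_zero_le)
  have hs1 := hσ 1 (hkσ 1 D.summand_one_le)
  have hs2 := hσ 2 (hkσ 2 D.summand_two_le)
  have hs3 := hσ 3 fun x hx => (D.mem_summand_three.1 hx).1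
  have ht0 := hτ 0 fun x hx => Or.inl hx
  have ht2 := hτ 2 fun x hx => Or.inr (Or.inl hx)
  have ht4 := hτ 4 fun x hx => Or.inr (Or.inr hx)
  simp (disch := decide +kernel) only [Fin.sum_univ_six, hz, h144, D.finrank_summand_zero,
    D.finrank_summand_one, D.finrank_summand_two, D.finrank_summand_three hpos,
    D.finrank_summand_four hpos, hA 0 3, hA 1 3, hA 2 3, hA 0 4, hA 1 4, hA 2 4, hA 0 5, hA 1 5,
    hA 2 5, hB 0 3, hB 1 3, hB 2 3, hB 0 4, hB 1 4, hB 2 4, hB 0 5, hB 1 5, hB 2 5, h354, h435,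
    h453, h534, h543] at hr0 hr1 hr2 hr3 hr4 hr5 hs0 hs1 hs2 hs3 ht0 ht2 ht4
  simp [E7II.signσ] at hs0 hs1 hs2 hs3
  simp [E7II.signτ] at ht0 ht2 ht4
  norm_num at hr0 hr1 hr2 hr3 hr4 hr5
  obtain ⟨l, m, k, hl, hm, hk, hlmk⟩ := D.exists_center_scalars hpos e he
  -- With $g=(1+c)/2$ and $b=(1+d)/2$, averaging the plain and the signed row sum keeps exactly the
  -- terms of sign $+1$.
  obtain ⟨⟨h1, h2, h3, h4⟩, ⟨h5, h6, h7⟩, h8⟩ := E7II.solve_relations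
    (n := Module.finrank ℝ (D.summand 5)) (g := (1 + c) / 2) (b := (1 + d) / 2)
    (x033 := tripleCoeff e 0 3 3) (x044 := tripleCoeff e 0 4 4) (x055 := tripleCoeff e 0 5 5)
    (x345 := tripleCoeff e 3 4 5) (x111 := tripleCoeff e 1 1 1) (x133 := tripleCoeff e 1 3 3)
    (x155 := tripleCoeff e 1 5 5) (x222 := tripleCoeff e 2 2 2) (x233 := tripleCoeff e 2 3 3)
    (x244 := tripleCoeff e 2 4 4) (x255 := tripleCoeff e 2 5 5)
    (by linarith) (by linarith) (by linarith) (by linarith) (by linarith) (by linarith)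
    (by linarith) (by linarith) (by linarith) (by linarith) (by linarith) (by linarith)
    (by linarith) hl hm hk (tripleCoeff_nonneg e _ _ _) (tripleCoeff_nonneg e _ _ _) hlmk
  exact ⟨⟨h1, h2, h3, h4⟩, ⟨h5, h6, h144, h7⟩, h8, hz⟩
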